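/- Identify the Euclidean plane with $\mathbb{C}$ and let $\omega = e^{i\pi/3}$. All rhombs below have unit sides and internal angles $60^\circ$ and $120^\circ$. Each side of a rhomb carries an arrow pointing towards the acute ($60^\circ$) vertex of the rhomb on that side, and one of the two colours red, black. A \emph{red} rhomb has four red sides; a \emph{black} rhomb has four black sides; a \emph{red\&black} rhomb has its two sides at one acute vertex red and its two sides at the other acute vertex black. The \emph{dual Turtle} is the tile formed by three red\&black rhombs and one red rhomb as follows. The three red\&black rhombs have the common obtuse vertex $0$, and together form the regular hexagon with vertices $\omega^k$ ($0\le k\le 5$); for $j=0,1,2$ the rhomb with vertices $0,\omega^{2j},\omega^{2j+1},\omega^{2j+2}$ has red sides at $\omega^{2j}$ and black sides at $\omega^{2j+2}$. The red rhomb has acute vertices $\omega^2, 2\omega$ and obtuse vertices $\omega,\omega+\omega^2$, and so is joined to the hexagon along the black side from $\omega$ to $\omega^2$. A \emph{dual Turtle tiling} is a set of tiles, each congruent (reflections allowed) to the dual Turtle or to a single black rhomb, which cover the plane, have pairwise disjoint interiors, and satisfy the matching rules: every side of every rhomb is also a side of another rhomb of the tiling, with the arrow pointing in the same direction and with the opposite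 colour. \textbf{Proposition.} The dual Turtle is not periodic: there is no dual Turtle tiling of the plane that is invariant under the translations by two linearly independent vectors. -/

import Mathlib

namespace DualTurtle

/-- The two colours of the matching rules. -/
inductive Colour
  | red
  | black

/-- The other colour. -/
def Colour.opp : Colour → Colour
  | .red => .black
  | .black => .red

/-- A side of a rhomb in the Euclidean plane `ℂ`: a segment with an arrow from `tail` to `head`,
together with a colour. -/
@[ext]
structure Side where
  tail : ℂ
  head : ℂ
  colour : Colour

/-- The side that is allowed to lie against `s`: the same segment with the same arrow, and the
opposite colour. -/
def Side.partner (s : Side) : Side := ⟨s.tail, s.head, s.colour.opp⟩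

/-- The image of a side under a map of the plane. -/
def Side.map (f : ℂ → ℂ) (s : Side) : Side := ⟨f s.tail, f s.head, s.colour⟩

/-- A decorated rhomb, given by the set of its (four) decorated sides. -/
abbrev Rhomb := Set Side

/-- The image of a rhomb under a map of the plane. -/
def Rhomb.map (f : ℂ → ℂ) (r : Rhomb) : Rhomb := Side.map f '' r

/-- The closed region of the plane that a rhomb occupies. -/
def Rhomb.region (r : Rhomb) : Set ℂ :=
  convexHull ℝ {z | ∃ s ∈ r, z = s.tail ∨ z = s.head}

/-- A tile, given by the set of the decorated rhombs that are joined to form it. -/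
abbrev Tile := Set Rhomb

/-- The image of a tile under a map of the plane. -/
def Tile.map (f : ℂ → ℂ) (t : Tile) : Tile := Rhomb.map f '' t

/-- The closed region of the plane that a tile occupies. -/
def Tile.region (t : Tile) : Set ℂ := ⋃ r ∈ t, Rhomb.region r

/-- The decorated rhomb with acute vertices `a`, `a'` and obtuse vertices `o`, `o'`. All arrows
point towards the acute vertices. The rhomb is cut along its short diagonal; the two sides
at `a` have colour `c` and the two sides at `a'` have colour `c'`. -/
def rhomb (a a' o o' : ℂ) (c c' : Colour) : Rhomb :=
  {⟨o, a, c⟩, ⟨o', a, c⟩, ⟨o, a', c'⟩, ⟨o', a', c'⟩}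

/-- The primitive sixth root of unity `exp (π i / 3)`. -/
noncomputable def ω : ℂ := Complex.exp (Real.pi * Complex.I / 3)

/-- The dual Turtle, in standard position: three red and black 60 degree rhombs with unit sides,
joined around the common obtuse vertex `0` into a regular hexagon with vertices `ω ^ k`, and a red
60 degree rhomb joined to the black side of the hexagon from `ω` to `ω ^ 2`. -/
noncomputable def dualTurtle : Tile :=
  {rhomb 1 (ω ^ 2) 0 ω .red .black,
   rhomb (ω ^ 2) (ω ^ 4) 0 (ω ^ 3) .red .black,
   rhomb (ω ^ 4) 1 0 (ω ^ 5) .red .black,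
   rhomb (ω ^ 2) (2 * ω) ω (ω + ω ^ 2) .red .red}

/-- The black 60 degree rhomb with unit sides, in standard position. -/
noncomputable def blackTile : Tile :=
  {rhomb 0 (1 + ω) 1 ω .black .black}

/-- `s` is a side of one of the rhombs of the tiling `𝒯`. -/
def IsSideOf (𝒯 : Set Tile) (s : Side) : Prop := ∃ t ∈ 𝒯, ∃ r ∈ t, s ∈ r

/-- `𝒯` is a dual Turtle tiling of the plane. -/
structure IsTiling (𝒯 : Set Tile) : Prop where
  /-- Each tile is congruent (a reflection being allowed) to the dual Turtle or the black rhomb. -/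
  congruent : ∀ t ∈ 𝒯, ∃ g : ℂ ≃ᵢ ℂ, t = Tile.map g dualTurtle ∨ t = Tile.map g blackTile
  /-- The tiles cover the plane. -/
  cover : ⋃ t ∈ 𝒯, Tile.region t = Set.univ
  /-- The tiles do not overlap. -/
  disjoint : ∀ t ∈ 𝒯, ∀ t' ∈ 𝒯, t ≠ t' →
    Disjoint (interior (Tile.region t)) (interior (Tile.region t'))
  /-- The rhombs match: against each side of a rhomb lies a side of another rhomb, with the same
  end points, the same arrow and the opposite colour. (As rhombs do not overlap, no third rhomb
  can have that segment as a side.) -/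
  matching : ∀ s, IsSideOf 𝒯 s → IsSideOf 𝒯 s.partner

/-- The set of tiles `𝒯` is mapped to itself by the translation by `v`. -/
def InvariantUnder (𝒯 : Set Tile) (v : ℂ) : Prop :=
  Tile.map (fun z => z + v) '' 𝒯 = 𝒯

end DualTurtle

/-! Arrows match only head to head, so rhombs meet acute vertex to acute vertex. Turning about an
acute vertex, the six rhombs there alternate in colour (`IsTiling.next`). Hence the acute vertices
form a triangular lattice, each lattice edge is the long diagonal of one rhomb, and the colours at a
vertex are recorded by one sign, the colour of the rhomb in a fixed direction
(`IsTiling.exists_lattice`). An edge is red and black exactly when its end points have equal signs.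
The hexagon of a dual Turtle is a lattice triangle, its hub. The tiles then say that each edge with
equal signs is a side of exactly one hub, that other edges belong to no hub (`IsTiling.hub_count`),
and that red edges correspond to hubs one to one (`IsTiling.joint_count`). Two independent periods
carry all this to the torus `ZMod m × ZMod m`.

There `torus_contradiction` compares areas. With `H` hubs on the torus, `3 H` of the `3 m ^ 2` edges
are red and black, and half of the others are red; since the red edges number `H`, `5 H = 3 m ^ 2`.
Deform the lattice: keep each red edge, contract each black edge to a point, and turn each red and
black edge by 60 degrees, the sense depending on the sign and on whether its hub points up or down.
These displacements close up. A triangle with three equal signs stays a unit triangle; any other has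
a black edge and collapses to zero area. The deformed torus therefore has `2 / 5` of the original
area.

On average the deformation is multiplication by a complex number with real part `1 / 2`, because red
edges have real part `1`, black ones `0` and the turned ones `1 / 2` relative to their original
direction. By `card_mul_sum_area` its squared modulus equals the area ratio `2 / 5`. With `Y / m ^
2` the coefficient of `ω`, this reads `1 / 4 + 3 / 4 * (Y / m ^ 2) ^ 2 = 2 / 5`, so `m ^ 4 = 5 Y ^
2`, which is impossible since `√5` is irrational. -/

namespace DualTurtle

/-! ### Area and colour counts on the discrete torus -/

section Torus

variable {m : ℕ} [NeZero m]

/-- The standard symplectic form, that is the oriented area form in the basis `1, ω`. -/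
def areaForm (z w : ℤ × ℤ) : ℤ := z.1 * w.2 - z.2 * w.1

lemma areaForm_sum_left {ι : Type*} (S : Finset ι) (f : ι → ℤ × ℤ) (w : ℤ × ℤ) :
    areaForm (∑ i ∈ S, f i) w = ∑ i ∈ S, areaForm (f i) w := by
  simp only [areaForm, Prod.fst_sum, Prod.snd_sum, Finset.sum_mul, Finset.sum_sub_distrib]

lemma areaForm_sum_right {ι : Type*} (S : Finset ι) (f : ι → ℤ × ℤ) (z : ℤ × ℤ) :
    areaForm z (∑ i ∈ S, f i) = ∑ i ∈ S, areaForm z (f i) := by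
  simp only [areaForm, Prod.fst_sum, Prod.snd_sum, Finset.mul_sum, Finset.sum_sub_distrib]

lemma sum_shift {M : Type*} [AddCommMonoid M] (d : ZMod m × ZMod m)
    (f : ZMod m × ZMod m → M) : ∑ v, f (v + d) = ∑ v, f v :=
  Equiv.sum_comp (Equiv.addRight d) f

lemma sum_shift_sub {M : Type*} [AddCommMonoid M] (d : ZMod m × ZMod m)
    (f : ZMod m × ZMod m → M) : ∑ v, f (v - d) = ∑ v, f v :=
  Equiv.sum_comp (Equiv.subRight d) f

/-- A function on the discrete torus that is invariant under both unit steps is constant. -/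
lemma eq_zero_of_step {α : Type*} (f : ZMod m × ZMod m → α)
    (h0 : ∀ v, f (v + (1, 0)) = f v) (h1 : ∀ v, f (v + (0, 1)) = f v) (v : ZMod m × ZMod m) :
    f v = f 0 := by
  have a (n : ℕ) (v) : f (v + ((n : ZMod m), 0)) = f v := by
    induction n with
    | zero => congr 1; ext <;> simp
    | succ n ih =>
      have e : v + (((n + 1 : ℕ) : ZMod m), 0) = v + ((n : ZMod m), 0) + (1, 0) := by
        ext <;> simp [add_assoc]
      rw [e, h0, ih]
  have b (n : ℕ) (v) : f (v + (0, (n : ZMod m))) = f v := by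
    induction n with
    | zero => congr 1; ext <;> simp
    | succ n ih =>
      have e : v + (0, ((n + 1 : ℕ) : ZMod m)) = v + (0, (n : ZMod m)) + (0, 1) := by
        ext <;> simp [add_assoc]
      rw [e, h1, ih]
  have := (b v.2.val (0 + ((v.1.val : ZMod m), 0))).trans (a v.1.val 0)
  rw [← this]; congr 1; ext <;> simp

/-- The correlation of two vector valued functions on the discrete torus. -/
def corr (f g : ZMod m × ZMod m → ℤ × ℤ) (d : ZMod m × ZMod m) : ℤ :=
  ∑ v, areaForm (f v) (g (v + d))

lemma corr_neg (f : ZMod m × ZMod m → ℤ × ℤ) (d : ZMod m × ZMod m) :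
    corr f f (-d) = - corr f f d := by
  unfold corr
  rw [← sum_shift d, ← Finset.sum_neg_distrib]
  refine Finset.sum_congr rfl fun v _ => ?_
  rw [add_neg_cancel_right]; simp only [areaForm]; ring

/-- The oriented areas of the images of the triangles under a closed form on the triangulated
torus add up to the area spanned by its periods. -/
theorem card_mul_sum_area (f g : ZMod m × ZMod m → ℤ × ℤ)
    (hcl : ∀ v, f v + g (v + (1, 0)) = g v + f (v + (0, 1))) :
    (m : ℤ) ^ 2 * ∑ v, (areaForm (f v) (g v) + areaForm (f (v + (0, 1))) (g (v + (1, 0)))) =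
      2 * areaForm (∑ v, f v) (∑ v, g v) := by
  -- Closedness turns a difference of `g` in direction `(1, 0)` into a difference of `f` in
  -- direction `(0, 1)`. For `hy` the difference is first shifted onto the left argument.
  have hx (d) : corr f g (d + (1, 0)) - corr f g d = corr f f (d + (0, 1)) - corr f f d := by
    unfold corr
    rw [← Finset.sum_sub_distrib, ← Finset.sum_sub_distrib]
    refine Finset.sum_congr rfl fun v _ => ?_
    have := hcl (v + d)
    rw [← add_assoc, ← add_assoc]
    simp only [areaForm]
    have h1 := congrArg Prod.fst this
    have h2 := congrArg Prod.snd this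
    simp only [Prod.fst_add, Prod.snd_add] at h1 h2
    linear_combination (f v).1 * h2 - (f v).2 * h1
  have hy (d) : corr f g (d + (0, 1)) - corr f g d =
      corr g g (d + (0, 1)) - corr g g (d + (0, 1) - (1, 0)) := by
    have e1 : corr f g d = ∑ v, areaForm (f (v + (0, 1))) (g (v + (d + (0, 1)))) := by
      unfold corr; rw [← sum_shift (0, 1)]
      refine Finset.sum_congr rfl fun v _ => ?_
      congr 2; abel
    have e2 : corr g g (d + (0, 1) - (1, 0)) =
        ∑ v, areaForm (g (v + (1, 0))) (g (v + (d + (0, 1)))) := by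
      unfold corr; rw [← sum_shift (1, 0)]
      refine Finset.sum_congr rfl fun v _ => ?_
      congr 2; abel
    rw [e1, e2]
    unfold corr
    rw [← Finset.sum_sub_distrib, ← Finset.sum_sub_distrib]
    refine Finset.sum_congr rfl fun v _ => ?_
    have := hcl v
    simp only [areaForm]
    have h1 := congrArg Prod.fst this
    have h2 := congrArg Prod.snd this
    simp only [Prod.fst_add, Prod.snd_add] at h1 h2
    linear_combination h1 * (g (v + (d + (0, 1)))).2 - h2 * (g (v + (d + (0, 1)))).1
  -- The reflection of `d` is chosen so that, by the oddness in `corr_neg`, the increments of the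
  -- two summands cancel. So `Φ` is constant: its value at `0` is the sum of the triangle areas, and
  -- its average is given by the total sums of `f` and `g`.
  set Φ : ZMod m × ZMod m → ℤ := fun d => corr f g d + corr f g ((1, 0) - (0, 1) - d) with hΦ
  have c0 (d) : Φ (d + (1, 0)) = Φ d := by
    have a1 := hx d
    have a2 := hx (-(d + (0, 1)))
    have a3 := corr_neg f d
    have a4 := corr_neg f (d + (0, 1))
    have b1 : -(d + (0, 1)) + (0, 1) = -d := by abel
    have b2 : -(d + (0, 1)) + (1, 0) = (1, 0) - (0, 1) - d := by abel
    have b3 : (1, 0) - (0, 1) - (d + (1, 0)) = -(d + (0, 1)) := by abel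
    rw [b1, b2] at a2
    simp only [hΦ, b3]
    linarith
  have c1 (d) : Φ (d + (0, 1)) = Φ d := by
    have a1 := hy d
    have a2 := hy ((1, 0) - (0, 1) - (d + (0, 1)))
    have a3 := corr_neg g (d + (0, 1))
    have a4 := corr_neg g (d + (0, 1) - (1, 0))
    have b1 : (1, 0) - (0, 1) - (d + (0, 1)) + (0, 1) = (1, 0) - (0, 1) - d := by abel
    have b2 : (1, 0) - (0, 1) - d = -(d + (0, 1) - (1, 0)) := by abel
    have b3 : -(d + (0, 1) - (1, 0)) - (1, 0) = -(d + (0, 1)) := by abel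
    rw [b1, b2, b3] at a2
    simp only [hΦ]
    rw [b2]
    linarith
  have hconst := eq_zero_of_step Φ c0 c1
  have hcard : (Fintype.card (ZMod m × ZMod m) : ℤ) = (m : ℤ) ^ 2 := by
    rw [Fintype.card_prod, ZMod.card]; push_cast; ring
  have htot : ∑ d, corr f g d = areaForm (∑ v, f v) (∑ v, g v) := by
    unfold corr
    rw [Finset.sum_comm, areaForm_sum_left]
    refine Finset.sum_congr rfl fun v _ => ?_
    rw [areaForm_sum_right]
    exact Equiv.sum_comp (Equiv.addLeft v) fun w => areaForm (f v) (g w)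
  have htot' : ∑ d, corr f g ((1, 0) - (0, 1) - d) = areaForm (∑ v, f v) (∑ v, g v) := by
    rw [← htot]
    exact Equiv.sum_comp (Equiv.subLeft ((1, 0) - (0, 1))) (corr f g)
  have hsum : ∑ d, Φ d = (m : ℤ) ^ 2 * Φ 0 := by
    rw [Finset.sum_congr rfl fun d _ => hconst d, Finset.sum_const, Finset.card_univ, nsmul_eq_mul,
      ← hcard]
  have h0 : Φ 0 = ∑ v, (areaForm (f v) (g v) + areaForm (f (v + (0, 1))) (g (v + (1, 0)))) := by
    rw [Finset.sum_add_distrib]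
    simp only [hΦ, corr, add_zero, sub_zero]
    congr 1
    rw [← sum_shift (0, 1)]
    refine Finset.sum_congr rfl fun v _ => ?_
    congr 2; abel
  rw [← h0, ← hsum, hΦ, Finset.sum_add_distrib, htot, htot']
  ring

/-- No spin configuration on the discrete torus has the combinatorics of a dual Turtle tiling:
`u` and `d` indicate the hubs among the triangles pointing up and down. -/
theorem torus_contradiction (s u d : ZMod m × ZMod m → ℤ) (hs : ∀ v, s v = 1 ∨ s v = -1)
    (hu : ∀ v, 0 ≤ u v) (hd : ∀ v, 0 ≤ d v)
    (h0 : ∀ v, u (v + (0, 1)) + d v = if s (v + (0, 1)) = s (v + (0, 1) + (1, 0)) then 1 else 0)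
    (h1 : ∀ v, u (v + (1, 0)) + d v = if s (v + (1, 0)) = s (v + (0, 1) + (1, 0)) then 1 else 0)
    (h2 : ∀ v, u v + d v = if s (v + (1, 0)) = s (v + (0, 1)) then 1 else 0)
    (hc : ∑ v, (u v + d v) = ∑ v,
      ((if s v = 1 ∧ s (v + (1, 0)) = -1 then 1 else 0) +
        (if s v = -1 ∧ s (v + (0, 1)) = 1 then 1 else 0) +
        (if s (v + (1, 0)) = 1 ∧ s (v + (0, 1)) = -1 then 1 else 0))) : False := by
  have h0' (v) : u v + d (v - (0, 1)) = if s v = s (v + (1, 0)) then 1 else 0 := by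
    have := h0 (v - (0, 1))
    rwa [sub_add_cancel] at this
  have h1' (v) : u v + d (v - (1, 0)) = if s v = s (v + (0, 1)) then 1 else 0 := by
    have := h1 (v - (1, 0))
    rwa [sub_add_cancel, show v - (1, 0) + (0, 1) + (1, 0) = v + (0, 1) by abel] at this
  -- Indicators of the red edges in the three directions.
  let r0 : ZMod m × ZMod m → ℤ := fun v => if s v = 1 ∧ s (v + (1, 0)) = -1 then 1 else 0
  let r1 : ZMod m × ZMod m → ℤ := fun v => if s v = -1 ∧ s (v + (0, 1)) = 1 then 1 else 0
  let r2 : ZMod m × ZMod m → ℤ :=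
    fun v => if s (v + (1, 0)) = 1 ∧ s (v + (0, 1)) = -1 then 1 else 0
  -- In the basis `1, ω` these are `ω` and `1 - ω = ω⁻¹`, the unit vector turned by 60 degrees
  -- either way. `f` and `g'` are displacements relative to the original edge direction; `g` is `ω`
  -- times `g'`, since its edges have direction `ω`.
  let w : ℤ → ℤ × ℤ := fun k => if k = 1 then (0, 1) else (1, -1)
  let f : ZMod m × ZMod m → ℤ × ℤ := fun v =>
    (r0 v, 0) + u v • w (s v) + d (v - (0, 1)) • w (-s v)
  let g' : ZMod m × ZMod m → ℤ × ℤ := fun v =>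
    (r1 v, 0) + u v • w (s v) + d (v - (1, 0)) • w (-s v)
  let g : ZMod m × ZMod m → ℤ × ℤ := fun v => (-(g' v).2, (g' v).1 + (g' v).2)
  have huv (v) : u v = 0 ∨ u v = 1 := by
    have a := hu v; have b := hd v; have c := h2 v
    split_ifs at c <;> omega
  have hdv (v) : d v = 0 ∨ d v = 1 := by
    have a := hu v; have b := hd v; have c := h2 v
    split_ifs at c <;> omega
  -- The displacements close up around each pair of adjacent triangles: a finite check over the four
  -- signs and the two hub indicators.
  have hcl (v) : f v + g (v + (1, 0)) = g v + f (v + (0, 1)) := by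
    have e1 := h0 v
    have e2 := h1 v
    have e3 := h2 v
    have e4 := h0' v
    have e5 := h1' v
    have p1 := huv v
    have p2 := hdv v
    have q1 := hu (v + (1, 0))
    have q2 := hu (v + (0, 1))
    have q3 := hd (v - (1, 0))
    have q4 := hd (v - (0, 1))
    have e : v + (1, 0) + (0, 1) = v + (0, 1) + (1, 0) := by abel
    simp only [f, g, g', r0, r1, w, add_sub_cancel_right, e]
    rcases hs v with a | a <;> rcases hs (v + (1, 0)) with b | b <;>
      rcases hs (v + (0, 1)) with c | c <;> rcases hs (v + (0, 1) + (1, 0)) with d' | d' <;>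
      rcases p1 with p1 | p1 <;> rcases p2 with p2 | p2 <;>
      simp [a, b, c, d', p1, p2] at e1 e2 e3 e4 e5 ⊢ <;> omega
  -- Each triangle contributes its number of edges with equal signs minus one: `2` if all three
  -- signs agree, and `0` otherwise, when exactly one edge has equal signs.
  have harea (v) : 2 * (areaForm (f v) (g v) + areaForm (f (v + (0, 1))) (g (v + (1, 0)))) =
      (u v + d (v - (0, 1))) + (u v + d (v - (1, 0))) + 2 * (u v + d v) +
        (u (v + (0, 1)) + d v) + (u (v + (1, 0)) + d v) - 2 := by
    have e1 := h0 v
    have e2 := h1 v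
    have e3 := h2 v
    have e4 := h0' v
    have e5 := h1' v
    have p1 := huv v
    have p2 := hdv v
    have q1 := hu (v + (1, 0))
    have q2 := hu (v + (0, 1))
    have q3 := hd (v - (1, 0))
    have q4 := hd (v - (0, 1))
    have e : v + (1, 0) + (0, 1) = v + (0, 1) + (1, 0) := by abel
    simp only [f, g, g', r0, r1, w, add_sub_cancel_right, e, areaForm]
    rcases hs v with a | a <;> rcases hs (v + (1, 0)) with b | b <;>
      rcases hs (v + (0, 1)) with c | c <;> rcases hs (v + (0, 1) + (1, 0)) with d' | d' <;>
      rcases p1 with p1 | p1 <;> rcases p2 with p2 | p2 <;>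
      simp [a, b, c, d', p1, p2] at e1 e2 e3 e4 e5 ⊢ <;> first | omega | simp [e1, e2, e4, e5]
  have hcard : ∑ _v : ZMod m × ZMod m, (1 : ℤ) = (m : ℤ) ^ 2 := by
    rw [Finset.sum_const, Finset.card_univ, Fintype.card_prod, ZMod.card]; simp; ring
  -- The sign differences telescope on the torus, so in each direction there are as many red edges
  -- as black ones.
  have hcolour0 (v) : 4 * r0 v = 2 * 1 - 2 * (u v + d (v - (0, 1))) + s v - s (v + (1, 0)) := by
    have e := h0' v
    simp only [r0]
    rcases hs v with a | a <;> rcases hs (v + (1, 0)) with b | b <;> simp [a, b] at e ⊢ <;> omega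
  have hcolour1 (v) : 4 * r1 v = 2 * 1 - 2 * (u v + d (v - (1, 0))) + s (v + (0, 1)) - s v := by
    have e := h1' v
    simp only [r1]
    rcases hs v with a | a <;> rcases hs (v + (0, 1)) with b | b <;> simp [a, b] at e ⊢ <;> omega
  have hcolour2 (v) :
      4 * r2 v = 2 * 1 - 2 * (u v + d v) + s (v + (1, 0)) - s (v + (0, 1)) := by
    have e := h2 v
    simp only [r2]
    rcases hs (v + (1, 0)) with a | a <;> rcases hs (v + (0, 1)) with b | b <;>
      simp [a, b] at e ⊢ <;> omega
  have hc' : ∑ v, u v + ∑ v, d v = ∑ v, r0 v + ∑ v, r1 v + ∑ v, r2 v := by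
    rw [← Finset.sum_add_distrib, hc, Finset.sum_add_distrib, Finset.sum_add_distrib]
  have s0 := Finset.sum_congr rfl fun v (_ : v ∈ Finset.univ) => hcolour0 v
  have s1 := Finset.sum_congr rfl fun v (_ : v ∈ Finset.univ) => hcolour1 v
  have s2 := Finset.sum_congr rfl fun v (_ : v ∈ Finset.univ) => hcolour2 v
  have sa := Finset.sum_congr rfl fun v (_ : v ∈ Finset.univ) => harea v
  simp only [← Finset.mul_sum, Finset.sum_add_distrib, Finset.sum_sub_distrib, sum_shift,
    sum_shift_sub, hcard] at s0 s1 s2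
  -- The left side is twice the real part of `f v`: `2` for a red edge, `1` for a turned one, `0`
  -- for a black one.
  have hlin0 (v) : 2 * (f v).1 + (f v).2 = 2 * r0 v + u v + d (v - (0, 1)) := by
    simp only [f, w]
    rcases hs v with a | a <;> simp [a] <;> ring
  have hlin1 (v) : 2 * (g' v).1 + (g' v).2 = 2 * r1 v + u v + d (v - (1, 0)) := by
    simp only [g', w]
    rcases hs v with a | a <;> simp [a] <;> ring
  have hf2 : ∑ v, (f v).2 = ∑ v, s v * u v + ∑ v, -s (v + (0, 1)) * d v := by
    rw [← sum_shift_sub (0, 1) fun v => -s (v + (0, 1)) * d v, ← Finset.sum_add_distrib]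
    refine Finset.sum_congr rfl fun v _ => ?_
    simp only [f, w, sub_add_cancel]
    rcases hs v with a | a <;> simp [a]
  have hg2 : ∑ v, (g' v).2 = ∑ v, s v * u v + ∑ v, -s (v + (1, 0)) * d v := by
    rw [← sum_shift_sub (1, 0) fun v => -s (v + (1, 0)) * d v, ← Finset.sum_add_distrib]
    refine Finset.sum_congr rfl fun v _ => ?_
    simp only [g', w, sub_add_cancel]
    rcases hs v with a | a <;> simp [a]
  -- Both are the same signed count of hubs, because the end points `v + (1, 0)` and `v + (0, 1)` of
  -- a side of a downward hub have equal signs.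
  have hfg2 : ∑ v, (g' v).2 = ∑ v, (f v).2 := by
    rw [hf2, hg2]
    congr 1
    refine Finset.sum_congr rfl fun v _ => ?_
    have e := h2 v
    have p := hu v
    rcases hdv v with q | q
    · simp [q]
    · split_ifs at e with h
      · rw [h]
      · omega
  have t0 := Finset.sum_congr rfl fun v (_ : v ∈ Finset.univ) => hlin0 v
  have t1 := Finset.sum_congr rfl fun v (_ : v ∈ Finset.univ) => hlin1 v
  simp only [← Finset.mul_sum, Finset.sum_add_distrib, sum_shift_sub] at t0 t1
  have hst := card_mul_sum_area f g hcl
  have hf : ∑ v, f v = (∑ v, (f v).1, ∑ v, (f v).2) := by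
    ext <;> simp [Prod.fst_sum, Prod.snd_sum]
  have hg : ∑ v, g v = (-∑ v, (g' v).2, ∑ v, (g' v).1 + ∑ v, (g' v).2) := by
    ext <;> simp [g, Prod.fst_sum, Prod.snd_sum, Finset.sum_add_distrib]
  rw [hf, hg] at hst
  rw [← Finset.mul_sum] at sa
  generalize ∑ v, (areaForm (f v) (g v) + areaForm (f (v + (0, 1))) (g (v + (1, 0)))) = Ar
    at hst sa
  rw [Finset.sum_sub_distrib] at sa
  simp only [Finset.sum_add_distrib, ← Finset.mul_sum, sum_shift, sum_shift_sub] at sa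
  rw [show ∑ _v : ZMod m × ZMod m, (2 : ℤ) = 2 * (m : ℤ) ^ 2 by
    rw [← hcard, Finset.mul_sum]; rfl] at sa
  rw [hfg2] at hst t1
  simp only [areaForm] at hst
  generalize ∑ v, (f v).1 = X at *
  generalize ∑ v, (f v).2 = Y at *
  generalize ∑ v, (g' v).1 = X' at *
  generalize ∑ v, u v = U at *
  generalize ∑ v, d v = D at *
  generalize ∑ v, r0 v = R0 at *
  generalize ∑ v, r1 v = R1 at *
  generalize ∑ v, r2 v = R2 at *
  have hm : (m : ℤ) ≠ 0 := by exact_mod_cast NeZero.ne m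
  have ht : 3 * (m : ℤ) ^ 2 = 5 * (U + D) := by linarith
  have hX : X' = X := by linarith
  have hXY : 2 * X + Y = (m : ℤ) ^ 2 := by linarith
  have hAr : 5 * Ar = 4 * (m : ℤ) ^ 2 := by linarith
  have key : ((m : ℤ) ^ 2) ^ 2 = 5 * Y ^ 2 := by
    rw [hX] at hst
    have hY : Y = (m : ℤ) ^ 2 - 2 * X := by linarith
    subst hY
    have : 6 * ((m : ℤ) ^ 2) ^ 2 = 6 * (5 * ((m : ℤ) ^ 2 - 2 * X) ^ 2) := by
      linear_combination -4 * (m : ℤ) ^ 2 * hAr + 20 * hst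
    linarith
  have hY : (Y : ℝ) ≠ 0 := by
    rintro h
    have h : Y = 0 := by exact_mod_cast h
    rw [h] at key
    exact pow_ne_zero 2 (pow_ne_zero 2 hm) (by simpa using key)
  have hp : Irrational (√5) := by
    simpa using Nat.Prime.irrational_sqrt (p := 5) (by norm_num)
  refine hp ⟨|(m : ℚ) ^ 2 / Y|, ?_⟩
  have key' : ((m : ℝ) ^ 2) ^ 2 = 5 * (Y : ℝ) ^ 2 := by exact_mod_cast key
  push_cast
  rw [eq_comm, Real.sqrt_eq_iff_mul_self_eq (by norm_num) (by positivity), abs_mul_abs_self]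
  field_simp
  linarith

end Torus

/-! ### Rhombs and dual Turtles described by their acute vertices -/

open ComplexConjugate

lemma ω_eq : ω = 1 / 2 + (√3 / 2 : ℝ) * Complex.I := by
  rw [ω, show (Real.pi * Complex.I / 3 : ℂ) = (Real.pi / 3 : ℝ) * Complex.I by push_cast; ring,
    Complex.exp_mul_I, ← Complex.ofReal_cos, ← Complex.ofReal_sin, Real.cos_pi_div_three,
    Real.sin_pi_div_three]
  push_cast; ring

lemma ω_re : ω.re = 1 / 2 := by rw [ω_eq]; simp

lemma ω_im : ω.im = √3 / 2 := by rw [ω_eq]; simp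

lemma ω_sq : ω ^ 2 = ω - 1 := by
  have h : √3 * √3 = 3 := Real.mul_self_sqrt (by norm_num)
  apply Complex.ext
  · simp only [sq, Complex.mul_re, ω_re, ω_im, Complex.sub_re, Complex.one_re]; linarith
  · simp only [sq, Complex.mul_im, ω_re, ω_im, Complex.sub_im, Complex.one_im]; ring

lemma conj_ω : conj ω = 1 - ω := by
  apply Complex.ext <;> simp [ω_re, ω_im]; norm_num

lemma ω_ne_zero : ω ≠ 0 := Complex.exp_ne_zero _

lemma ω_im_pos : 0 < ω.im := by rw [ω_im]; positivity

lemma int_add_ω_eq_zero {x y : ℝ} (h : (x : ℂ) + y * ω = 0) : x = 0 ∧ y = 0 := by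
  have h2 := congrArg Complex.im h
  have h1 := congrArg Complex.re h
  simp [ω_re] at h1 h2
  have : y = 0 := h2.resolve_right ω_im_pos.ne'
  exact ⟨by simpa [this] using h1, this⟩

lemma one_sub_ω_ne_zero : (1 : ℂ) - ω ≠ 0 := by
  intro h
  have := congrArg Complex.im h
  simp [ω_im] at this

lemma one_sub_two_ω_ne_zero : (1 : ℂ) - 2 * ω ≠ 0 := by
  intro h
  have := congrArg Complex.im h
  simp [ω_im] at this

lemma one_add_ω_ne_zero : (1 : ℂ) + ω ≠ 0 := by
  intro h
  have := congrArg Complex.im h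
  simp [ω_im] at this

lemma two_sub_ω_ne_zero : (2 : ℂ) - ω ≠ 0 := by
  intro h
  have := congrArg Complex.im h
  simp [ω_im] at this

lemma rhomb_comm (a a' o o' : ℂ) (c c' : Colour) : rhomb a a' o o' c c' = rhomb a' a o o' c' c := by
  ext s; simp only [rhomb, Set.mem_insert_iff, Set.mem_singleton_iff]; tauto

lemma rhomb_comm_obtuse (a a' o o' : ℂ) (c c' : Colour) :
    rhomb a a' o o' c c' = rhomb a a' o' o c c' := by
  ext s; simp only [rhomb, Set.mem_insert_iff, Set.mem_singleton_iff]; tauto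

lemma rhomb_map (f : ℂ → ℂ) (a a' o o' : ℂ) (c c' : Colour) :
    Rhomb.map f (rhomb a a' o o' c c') = rhomb (f a) (f a') (f o) (f o') c c' := by
  simp [Rhomb.map, rhomb, Set.image_insert_eq, Side.map]

/-- The decorated 60 degree rhomb with acute vertices `p` and `q`. -/
noncomputable def acuteRhomb (p q : ℂ) (c c' : Colour) : Rhomb :=
  rhomb p q (p + (q - p) * ((1 + ω) / 3)) (p + (q - p) * ((2 - ω) / 3)) c c'

/-- The dual Turtle whose hub is the triangle `p`, `q`, `r`. -/
noncomputable def turtle (p q r : ℂ) : Tile :=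
  {acuteRhomb p q .red .black, acuteRhomb q r .red .black, acuteRhomb r p .red .black,
    acuteRhomb q (p + q - r) .red .red}

/-- `p`, `q`, `r` are the vertices of an equilateral triangle. -/
def Equilateral (p q r : ℂ) : Prop :=
  p ≠ q ∧ (r = p + (q - p) * ω ∨ r = p + (q - p) * (1 - ω))

lemma acuteRhomb_comm (p q : ℂ) (c c' : Colour) : acuteRhomb p q c c' = acuteRhomb q p c' c := by
  rw [acuteRhomb, rhomb_comm, rhomb_comm_obtuse, acuteRhomb]
  congr 1 <;> ring

/-- An isometry of the plane in complex form. -/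
lemma isometry_eq (g : ℂ ≃ᵢ ℂ) : ∃ α β : ℂ, α ≠ 0 ∧
    ((∀ z, g z = α * z + β) ∨ ∀ z, g z = α * conj z + β) := by
  let G := g.toRealAffineIsometryEquiv
  have hG (z : ℂ) : g z = G.linearIsometryEquiv z + g 0 := by
    have := G.map_vadd 0 z
    simpa [G] using this
  obtain ⟨a, ha⟩ := linear_isometry_complex G.linearIsometryEquiv
  refine ⟨a, g 0, Circle.coe_ne_zero a, ?_⟩
  rcases ha with ha | ha
  · left; intro z; rw [hG, ha]; simp
  · right; intro z; rw [hG, ha]; simp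

/-- A reflection only exchanges the two obtuse vertices, so acute vertices and colours suffice to
follow a rhomb under any isometry. -/
lemma acuteRhomb_map (g : ℂ ≃ᵢ ℂ) (p q : ℂ) (c c' : Colour) :
    Rhomb.map g (acuteRhomb p q c c') = acuteRhomb (g p) (g q) c c' := by
  obtain ⟨α, β, -, h | h⟩ := isometry_eq g
  · rw [acuteRhomb, rhomb_map, acuteRhomb]
    simp only [h]
    congr 1 <;> ring
  · rw [acuteRhomb, rhomb_map, acuteRhomb, rhomb_comm_obtuse]
    simp only [h, map_add, map_mul, map_sub, map_div₀, map_one, map_ofNat, conj_ω]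
    congr 1 <;> ring

lemma dualTurtle_eq : dualTurtle = turtle 1 (ω ^ 2) (ω ^ 4) := by
  have h2 := ω_sq
  have h3 : ω ^ 3 = -1 := by linear_combination (ω + 1) * h2
  have h4 : ω ^ 4 = -ω := by linear_combination ω * h3
  have h5 : ω ^ 5 = 1 - ω := by linear_combination ω ^ 2 * h3 - h2
  have e1 : rhomb 1 (ω ^ 2) 0 ω = acuteRhomb 1 (ω ^ 2) := by
    funext c c'
    rw [acuteRhomb, h2]
    congr 1
    · linear_combination (-1 / 3) * h2
    · linear_combination (1 / 3) * h2
  have e2 : rhomb (ω ^ 2) (ω ^ 4) 0 (ω ^ 3) = acuteRhomb (ω ^ 2) (ω ^ 4) := by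
    funext c c'
    rw [acuteRhomb, h2, h3, h4]
    congr 1
    · linear_combination (2 / 3) * h2
    · linear_combination (-2 / 3) * h2
  have e3 : rhomb (ω ^ 4) 1 0 (ω ^ 5) = acuteRhomb (ω ^ 4) 1 := by
    funext c c'
    rw [acuteRhomb, h4, h5]
    congr 1
    · linear_combination (-1 / 3) * h2
    · linear_combination (1 / 3) * h2
  have e4 : rhomb (ω ^ 2) (2 * ω) ω (ω + ω ^ 2) = acuteRhomb (ω ^ 2) (1 + ω ^ 2 - ω ^ 4) := by
    funext c c'
    rw [acuteRhomb, rhomb_comm_obtuse, h2, h4]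
    congr 1
    · ring
    · linear_combination (-1 / 3) * h2
    · linear_combination (1 / 3) * h2
  rw [dualTurtle, e1, e2, e3, e4, turtle]

lemma blackTile_eq : blackTile = {acuteRhomb 0 (1 + ω) .black .black} := by
  have h2 := ω_sq
  rw [blackTile, acuteRhomb, rhomb_comm_obtuse]
  congr 2
  · linear_combination (-1 / 3) * h2
  · linear_combination (1 / 3) * h2

/-- The two kinds of tile. -/
lemma tile_cases {t : Tile} (g : ℂ ≃ᵢ ℂ)
    (h : t = Tile.map g dualTurtle ∨ t = Tile.map g blackTile) :
    (∃ p q, p ≠ q ∧ t = {acuteRhomb p q .black .black}) ∨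
      ∃ p q r, Equilateral p q r ∧ t = turtle p q r := by
  have h2 := ω_sq
  have h4 : ω ^ 4 = -ω := by linear_combination (ω ^ 2 + ω) * h2
  rcases h with rfl | rfl
  · right
    refine ⟨g 1, g (ω ^ 2), g (ω ^ 4), ⟨fun h => ?_, ?_⟩, ?_⟩
    · have := g.injective h
      rw [h2] at this
      exact two_sub_ω_ne_zero (by linear_combination this)
    · obtain ⟨α, β, -, h | h⟩ := isometry_eq g
      · left
        rw [h, h, h, h2, h4]
        linear_combination (-α) * h2
      · right
        rw [h, h, h, h2, h4]
        simp only [map_sub, map_neg, map_one, conj_ω]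
        linear_combination (-α) * h2
    · rw [dualTurtle_eq]
      have : g (1 + ω ^ 2 - ω ^ 4) = g 1 + g (ω ^ 2) - g (ω ^ 4) := by
        obtain ⟨α, β, -, h | h⟩ := isometry_eq g <;> simp only [h, map_add, map_sub] <;> ring
      simp only [Tile.map, turtle, Set.image_insert_eq, Set.image_singleton, acuteRhomb_map, this]
  · left
    refine ⟨g 0, g (1 + ω), fun h => ?_, ?_⟩
    · exact one_add_ω_ne_zero (g.injective h).symm
    · rw [blackTile_eq]
      simp [Tile.map, acuteRhomb_map]

lemma mem_acuteRhomb {p q : ℂ} {c c' : Colour} {s : Side} : s ∈ acuteRhomb p q c c' ↔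
    s = ⟨p + (q - p) * ((1 + ω) / 3), p, c⟩ ∨ s = ⟨p + (q - p) * ((2 - ω) / 3), p, c⟩ ∨
      s = ⟨p + (q - p) * ((1 + ω) / 3), q, c'⟩ ∨ s = ⟨p + (q - p) * ((2 - ω) / 3), q, c'⟩ := by
  simp [acuteRhomb, rhomb]

lemma exists_mem_acuteRhomb {p q : ℂ} {c c' : Colour} (z : ℂ) (k : Colour) :
    (∃ o, (⟨o, z, k⟩ : Side) ∈ acuteRhomb p q c c') ↔ z = p ∧ k = c ∨ z = q ∧ k = c' := by
  simp only [mem_acuteRhomb, Side.mk.injEq]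
  constructor
  · rintro ⟨o, h⟩; tauto
  · rintro (⟨rfl, rfl⟩ | ⟨rfl, rfl⟩)
    · exact ⟨_, Or.inl ⟨rfl, rfl, rfl⟩⟩
    · exact ⟨_, Or.inr (Or.inr (Or.inl ⟨rfl, rfl, rfl⟩))⟩

/-- A rhomb determines its acute vertices and their colours. -/
lemma acuteRhomb_inj {p q p' q' : ℂ} {c c' d d' : Colour} (hpq : p ≠ q) :
    acuteRhomb p q c c' = acuteRhomb p' q' d d' ↔
      (p = p' ∧ q = q' ∧ c = d ∧ c' = d') ∨ (p = q' ∧ q = p' ∧ c = d' ∧ c' = d) := by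
  constructor
  · intro h
    have h1 := (exists_mem_acuteRhomb (p := p') (q := q') (c := d) (c' := d') p c).1
      (h ▸ (exists_mem_acuteRhomb p c).2 (by simp))
    have h2 := (exists_mem_acuteRhomb (p := p') (q := q') (c := d) (c' := d') q c').1
      (h ▸ (exists_mem_acuteRhomb q c').2 (by simp))
    rcases h1 with ⟨rfl, rfl⟩ | ⟨rfl, rfl⟩ <;> rcases h2 with ⟨rfl, rfl⟩ | ⟨rfl, rfl⟩ <;>
      simp_all
  · rintro (⟨rfl, rfl, rfl, rfl⟩ | ⟨rfl, rfl, rfl, rfl⟩)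
    · rfl
    · exact acuteRhomb_comm _ _ _ _

lemma acuteRhomb_region (p q : ℂ) (c c' : Colour) : Rhomb.region (acuteRhomb p q c c') =
    convexHull ℝ {p, q, p + (q - p) * ((1 + ω) / 3), p + (q - p) * ((2 - ω) / 3)} := by
  rw [Rhomb.region]
  congr 1
  ext z
  simp only [acuteRhomb, rhomb, Set.mem_insert_iff, Set.mem_singleton_iff, Set.mem_ofPred_eq,
    exists_eq_or_imp, exists_eq_left]
  tauto

lemma mem_region (p q : ℂ) (c c' : Colour) {a b : ℝ} (ha : 0 ≤ a) (ha' : a ≤ 1) (hb : 0 ≤ b)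
    (hb' : b ≤ 1) : p + (q - p) * (a * ((1 + ω) / 3) + b * ((2 - ω) / 3)) ∈
      Rhomb.region (acuteRhomb p q c c') := by
  rw [acuteRhomb_region]
  set S : Set ℂ := {p, q, p + (q - p) * ((1 + ω) / 3), p + (q - p) * ((2 - ω) / 3)} with hS
  have hc := convex_convexHull ℝ S
  have m (z) (hz : z ∈ S) : z ∈ convexHull ℝ S := subset_convexHull ℝ S hz
  have h1 := hc (m p (by simp [hS])) (m (p + (q - p) * ((2 - ω) / 3)) (by simp [hS]))
    (sub_nonneg.2 hb') hb (by ring)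
  have h2 := hc (m (p + (q - p) * ((1 + ω) / 3)) (by simp [hS])) (m q (by simp [hS]))
    (sub_nonneg.2 hb') hb (by ring)
  have h3 := hc h1 h2 (sub_nonneg.2 ha') ha (by ring)
  convert h3 using 1
  simp only [Complex.real_smul]
  push_cast
  ring

lemma interior_region_nonempty {p q : ℂ} (hpq : p ≠ q) :
    ∃ z, ∀ c c', z ∈ interior (Rhomb.region (acuteRhomb p q c c')) := by
  have hqp : q - p ≠ 0 := sub_ne_zero.2 hpq.symm
  have h3 : √3 * √3 = 3 := Real.mul_self_sqrt (by norm_num)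
  let w : ℂ → ℂ := fun z => (z - p) / (q - p)
  -- The coordinates along the two sides at `p`, inverting the parametrisation of `mem_region`; the
  -- centre of the rhomb has both equal to `1 / 2`.
  let a : ℂ → ℝ := fun z => (w z).re + √3 * (w z).im
  let b : ℂ → ℝ := fun z => (w z).re - √3 * (w z).im
  have hw : Continuous w := by fun_prop
  have ha : Continuous a := by
    exact (Complex.continuous_re.comp hw).add (continuous_const.mul (Complex.continuous_im.comp hw))
  have hb : Continuous b := by
    exact (Complex.continuous_re.comp hw).sub (continuous_const.mul (Complex.continuous_im.comp hw))
  refine ⟨p + (q - p) / 2, fun c c' => ?_⟩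
  rw [mem_interior]
  refine ⟨a ⁻¹' Set.Ioo 0 1 ∩ b ⁻¹' Set.Ioo 0 1, ?_,
    (isOpen_Ioo.preimage ha).inter (isOpen_Ioo.preimage hb), ?_⟩
  · rintro z ⟨⟨h1, h2⟩, h4, h5⟩
    have := mem_region p q c c' h1.le h2.le h4.le h5.le
    convert this using 1
    have e : (a z : ℂ) * ((1 + ω) / 3) + b z * ((2 - ω) / 3) = w z := by
      apply Complex.ext
      · simp [ω_re, ω_im, a, b]; ring
      · simp [ω_re, ω_im, a, b]
        linear_combination ((w z).im / 3) * h3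
    rw [e]
    simp only [w]
    field_simp
    ring
  · have : w (p + (q - p) / 2) = (1 / 2 : ℝ) := by
      simp only [w]; push_cast; field_simp; ring
    constructor <;> constructor <;> simp only [a, b, this] <;> norm_num

lemma region_closure {p q z : ℂ} {c c' : Colour} (hpq : p ≠ q)
    (hz : z ∈ Rhomb.region (acuteRhomb p q c c')) :
    z ∈ closure (interior (Rhomb.region (acuteRhomb p q c c'))) := by
  obtain ⟨y, hy⟩ := interior_region_nonempty hpq
  rw [Convex.closure_interior_eq_closure_of_nonempty_interior
    (by rw [Rhomb.region]; exact convex_convexHull ℝ _) ⟨y, hy c c'⟩]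
  exact subset_closure hz

lemma Equilateral.ne {p q r : ℂ} (h : Equilateral p q r) :
    p ≠ q ∧ q ≠ r ∧ r ≠ p ∧ p + q - r ≠ r := by
  obtain ⟨hpq, h⟩ := h
  have hqp : q - p ≠ 0 := sub_ne_zero.2 hpq.symm
  have k1 : (q - p) * ω ≠ 0 := mul_ne_zero hqp ω_ne_zero
  have k2 : (q - p) * (1 - ω) ≠ 0 := mul_ne_zero hqp one_sub_ω_ne_zero
  have k3 : (q - p) * (1 - 2 * ω) ≠ 0 := mul_ne_zero hqp one_sub_two_ω_ne_zero
  refine ⟨hpq, ?_, ?_, ?_⟩ <;> rcases h with rfl | rfl <;> intro h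
  · exact k2 (by linear_combination h)
  · exact k1 (by linear_combination h)
  · exact k1 (by linear_combination h)
  · exact k2 (by linear_combination h)
  · exact k3 (by linear_combination h)
  · exact k3 (by linear_combination -h)

lemma acuteRhomb_mem_turtle {a b p q r : ℂ} {c c' : Colour} (hab : a ≠ b) :
    acuteRhomb a b c c' ∈ turtle p q r ↔
      (a = p ∧ b = q ∧ c = .red ∧ c' = .black) ∨ (a = q ∧ b = p ∧ c = .black ∧ c' = .red) ∨
      (a = q ∧ b = r ∧ c = .red ∧ c' = .black) ∨ (a = r ∧ b = q ∧ c = .black ∧ c' = .red) ∨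
      (a = r ∧ b = p ∧ c = .red ∧ c' = .black) ∨ (a = p ∧ b = r ∧ c = .black ∧ c' = .red) ∨
      (a = q ∧ b = p + q - r ∧ c = .red ∧ c' = .red) ∨
      (a = p + q - r ∧ b = q ∧ c = .red ∧ c' = .red) := by
  simp only [turtle, Set.mem_insert_iff, Set.mem_singleton_iff, acuteRhomb_inj hab, or_assoc]

lemma redBlack_mem_turtle {a b p q r : ℂ} (hab : a ≠ b) :
    acuteRhomb a b .red .black ∈ turtle p q r ↔
      (a = p ∧ b = q) ∨ (a = q ∧ b = r) ∨ (a = r ∧ b = p) := by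
  rw [acuteRhomb_mem_turtle hab]; simp

lemma red_mem_turtle {a b p q r : ℂ} (hab : a ≠ b) :
    acuteRhomb a b .red .red ∈ turtle p q r ↔
      (a = q ∧ b = p + q - r) ∨ (a = p + q - r ∧ b = q) := by
  rw [acuteRhomb_mem_turtle hab]; simp

/-- The red and black rhombs fix the hub with its cyclic order, red end first; the red rhomb then
tells which of the three rotations it is. -/
lemma turtle_inj {p q r p' q' r' : ℂ} (h : Equilateral p q r) (h' : Equilateral p' q' r')
    (e : turtle p' q' r' = turtle p q r) : p' = p ∧ q' = q ∧ r' = r := by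
  obtain ⟨h1, h2, h3, h4⟩ := h.ne
  obtain ⟨h1', h2', h3', h4'⟩ := h'.ne
  have k1 : acuteRhomb p' q' .red .black ∈ turtle p q r := e ▸ by simp [turtle]
  have k2 : acuteRhomb q' r' .red .black ∈ turtle p q r := e ▸ by simp [turtle]
  have hx : q' ≠ p' + q' - r' := fun h => h3' (by linear_combination h)
  have k3 : acuteRhomb q' (p' + q' - r') .red .red ∈ turtle p q r := e ▸ by simp [turtle]
  rw [redBlack_mem_turtle h1'] at k1
  rw [redBlack_mem_turtle h2'] at k2
  rw [red_mem_turtle hx] at k3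
  have hp : p + q - r ≠ p := fun h => h2 (by linear_combination h)
  have k3' : q' = q ∨ q' = p + q - r := k3.imp And.left And.left
  grind

/-! ### Uniqueness of rhombs and the alternation of colours -/

variable {𝒯 : Set Tile}

lemma IsTiling.cases (h : IsTiling 𝒯) {t : Tile} (ht : t ∈ 𝒯) :
    (∃ p q, p ≠ q ∧ t = {acuteRhomb p q .black .black}) ∨
      ∃ p q r, Equilateral p q r ∧ t = turtle p q r := by
  obtain ⟨g, hg⟩ := h.congruent t ht
  exact tile_cases g hg

lemma IsTiling.eq_of_mem_interior (h : IsTiling 𝒯) {t t' : Tile} (ht : t ∈ 𝒯) (ht' : t' ∈ 𝒯)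
    {r r' : Rhomb} (hr : r ∈ t) (hr' : r' ∈ t') {z : ℂ} (hz : z ∈ interior (Rhomb.region r))
    (hz' : z ∈ interior (Rhomb.region r')) : t = t' := by
  by_contra hne
  exact Set.disjoint_left.1 (h.disjoint t ht t' ht' hne)
    (interior_mono (Set.subset_biUnion_of_mem (u := Rhomb.region) hr) hz)
    (interior_mono (Set.subset_biUnion_of_mem (u := Rhomb.region) hr') hz')

lemma IsTiling.exists_ne (h : IsTiling 𝒯) {t : Tile} (ht : t ∈ 𝒯) {r : Rhomb} (hr : r ∈ t) :
    ∃ p q c c', p ≠ q ∧ r = acuteRhomb p q c c' := by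
  obtain ⟨p, q, hpq, rfl⟩ | ⟨p, q, r, he, rfl⟩ := h.cases ht
  · exact ⟨p, q, _, _, hpq, hr⟩
  · obtain ⟨h1, h2, h3, h4⟩ := he.ne
    simp only [turtle, Set.mem_insert_iff, Set.mem_singleton_iff] at hr
    rcases hr with rfl | rfl | rfl | rfl
    · exact ⟨_, _, _, _, h1, rfl⟩
    · exact ⟨_, _, _, _, h2, rfl⟩
    · exact ⟨_, _, _, _, h3, rfl⟩
    · exact ⟨_, _, _, _, fun h => h3 (by linear_combination h), rfl⟩

/-- At most one rhomb of the tiling has given acute vertices. -/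
lemma IsTiling.unique (h : IsTiling 𝒯) {t t' : Tile} (ht : t ∈ 𝒯) (ht' : t' ∈ 𝒯) {p q : ℂ}
    (hpq : p ≠ q) {c c' d d' : Colour} (hr : acuteRhomb p q c c' ∈ t)
    (hr' : acuteRhomb p q d d' ∈ t') : t = t' ∧ c = d ∧ c' = d' := by
  obtain ⟨z, hz⟩ := interior_region_nonempty hpq
  obtain rfl := h.eq_of_mem_interior ht ht' hr hr' (hz c c') (hz d d')
  refine ⟨rfl, ?_⟩
  obtain ⟨a, b, hab, rfl⟩ | ⟨a, b, x, he, rfl⟩ := h.cases ht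
  · rw [Set.mem_singleton_iff, acuteRhomb_inj hpq] at hr hr'
    grind
  · obtain ⟨h1, h2, h3, h4⟩ := he.ne
    rw [acuteRhomb_mem_turtle hpq] at hr hr'
    have h5 : a + b - x ≠ a := fun h => h2 (by linear_combination h)
    have h6 : a + b - x ≠ b := fun h => h3 (by linear_combination -h)
    generalize a + b - x = y at *
    grind

/-- The tiling has a rhomb with acute vertices `p` and `q`, of colours `c` and `c'`. -/
def HasRhomb (𝒯 : Set Tile) (p q : ℂ) (c c' : Colour) : Prop :=
  ∃ t ∈ 𝒯, acuteRhomb p q c c' ∈ t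

lemma HasRhomb.symm {p q : ℂ} {c c' : Colour} (h : HasRhomb 𝒯 p q c c') :
    HasRhomb 𝒯 q p c' c := by
  obtain ⟨t, ht, hr⟩ := h
  exact ⟨t, ht, acuteRhomb_comm p q c c' ▸ hr⟩

lemma IsTiling.colours_eq (h : IsTiling 𝒯) {p q : ℂ} (hpq : p ≠ q) {c c' d d' : Colour}
    (h1 : HasRhomb 𝒯 p q c c') (h2 : HasRhomb 𝒯 p q d d') : c = d ∧ c' = d' := by
  obtain ⟨t, ht, hr⟩ := h1
  obtain ⟨t', ht', hr'⟩ := h2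
  exact (h.unique ht ht' hpq hr hr').2

lemma Colour.opp_ne (c : Colour) : c.opp ≠ c := by cases c <;> simp [Colour.opp]

/-- The next rhomb around an acute vertex. -/
lemma IsTiling.next (h : IsTiling 𝒯) {p q : ℂ} (hpq : p ≠ q) {c c' : Colour}
    (hr : HasRhomb 𝒯 p q c c') : ∃ c'', HasRhomb 𝒯 p (p + (q - p) * ω) c.opp c'' := by
  have h2 := ω_sq
  obtain ⟨t, ht, hr⟩ := hr
  obtain ⟨t', ht', r', hr', hs⟩ := h.matching ⟨p + (q - p) * ((1 + ω) / 3), p, c⟩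
    ⟨t, ht, _, hr, mem_acuteRhomb.2 (Or.inl rfl)⟩
  obtain ⟨p', q', d, d', hpq', rfl⟩ := h.exists_ne ht' hr'
  have key (q' : ℂ) (d' : Colour) (hr' : HasRhomb 𝒯 p q' c.opp d')
      (hs : p + (q - p) * ((1 + ω) / 3) = p + (q' - p) * ((1 + ω) / 3) ∨
        p + (q - p) * ((1 + ω) / 3) = p + (q' - p) * ((2 - ω) / 3)) :
      ∃ c'', HasRhomb 𝒯 p (p + (q - p) * ω) c.opp c'' := by
    -- Only two rhombs with acute vertex `p` contain this side. One has the acute vertices of the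
    -- given rhomb, but would have the wrong colour at `p`; the other is its image under a turn by
    -- 60 degrees.
    rcases hs with hs | hs
    · have : q = q' := by
        have h0 : (q - q') * (1 + ω) = 0 := by linear_combination 3 * hs
        exact sub_eq_zero.1 ((mul_eq_zero.1 h0).resolve_right one_add_ω_ne_zero)
      subst this
      exact absurd (h.colours_eq hpq hr' ⟨t, ht, hr⟩).1 c.opp_ne
    · have : q' = p + (q - p) * ω := by
        have h0 : (q' - (p + (q - p) * ω)) * (2 - ω) = 0 := by
          linear_combination -3 * hs + (q - p) * h2
        exact sub_eq_zero.1 ((mul_eq_zero.1 h0).resolve_right two_sub_ω_ne_zero)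
      exact ⟨d', this ▸ hr'⟩
  simp only [Side.partner, mem_acuteRhomb, Side.mk.injEq] at hs
  rcases hs with ⟨e1, rfl, rfl⟩ | ⟨e1, rfl, rfl⟩ | ⟨e1, rfl, rfl⟩ | ⟨e1, rfl, rfl⟩
  · exact key q' d' ⟨t', ht', hr'⟩ (Or.inl e1)
  · exact key q' d' ⟨t', ht', hr'⟩ (Or.inr e1)
  · exact key p' d (HasRhomb.symm ⟨t', ht', hr'⟩) (Or.inr (by rw [e1]; ring))
  · exact key p' d (HasRhomb.symm ⟨t', ht', hr'⟩) (Or.inl (by rw [e1]; ring))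

/-! ### Counting hubs at a rhomb -/

open Classical in
/-- The integer `1` if `turtle p q r` is a tile of the tiling, and `0` otherwise. -/
noncomputable def hub (𝒯 : Set Tile) (p q r : ℂ) : ℤ := if turtle p q r ∈ 𝒯 then 1 else 0

lemma hub_nonneg (p q r : ℂ) : 0 ≤ hub 𝒯 p q r := by
  unfold hub; split_ifs <;> norm_num

/-- The number of dual Turtles of the tiling with hub `p`, `q`, `r` in this cyclic order. -/
noncomputable def cyclicHub (𝒯 : Set Tile) (p q r : ℂ) : ℤ :=
  hub 𝒯 p q r + hub 𝒯 q r p + hub 𝒯 r p q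

lemma Equilateral.rotate {p q r : ℂ} (h : Equilateral p q r) : Equilateral q r p := by
  have h2 := ω_sq
  refine ⟨h.ne.2.1, ?_⟩
  rcases h.2 with rfl | rfl
  · left; linear_combination (p - q) * h2
  · right; linear_combination (p - q) * h2

lemma Equilateral.fst_eq {p q r : ℂ} (h : Equilateral p q r) :
    p = q + (p + q - r - q) * ω ∨ p = q + (p + q - r - q) * (1 - ω) := by
  have h2 := ω_sq
  rcases h.2 with rfl | rfl
  · right; linear_combination (p - q) * h2
  · left; linear_combination (p - q) * h2

lemma Equilateral.reflect {p q r : ℂ} (h : Equilateral p q r) : Equilateral r p (r + p - q) := by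
  have h2 := ω_sq
  refine ⟨h.ne.2.2.1, ?_⟩
  rcases h.2 with rfl | rfl
  · right; linear_combination (p - q) * h2
  · left; linear_combination (p - q) * h2

lemma Equilateral.swap {p q r : ℂ} (h : Equilateral p q r) : Equilateral q p r := by
  refine ⟨h.1.symm, ?_⟩
  rcases h.2 with rfl | rfl
  · right; ring
  · left; ring

lemma third_ne {a b : ℂ} (hab : a ≠ b) : a + (b - a) * ω ≠ a + (b - a) * (1 - ω) := by
  intro h
  have : (b - a) * (1 - 2 * ω) = 0 := by linear_combination -h
  exact mul_ne_zero (sub_ne_zero.2 hab.symm) one_sub_two_ω_ne_zero this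

/-- Once the tile containing a rhomb is known, any other candidate containing that rhomb is
excluded. The counts below thereby become comparisons of vertices. -/
lemma IsTiling.turtle_mem_iff (h : IsTiling 𝒯) {a b p q r x y z : ℂ} (hab : a ≠ b) {c c' : Colour}
    (he : Equilateral p q r) (ht : turtle p q r ∈ 𝒯) (hm : acuteRhomb a b c c' ∈ turtle p q r)
    (he' : Equilateral x y z) (hm' : acuteRhomb a b c c' ∈ turtle x y z) :
    turtle x y z ∈ 𝒯 ↔ x = p ∧ y = q ∧ z = r := by
  constructor
  · intro ht'
    exact turtle_inj he he' (h.unique ht ht' hab hm hm').1.symm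
  · rintro ⟨rfl, rfl, rfl⟩; exact ht

open Classical in
/-- A red and black rhomb belongs to exactly one hub. -/
lemma IsTiling.redBlack_count (h : IsTiling 𝒯) {a b : ℂ} (hab : a ≠ b) :
    cyclicHub 𝒯 a b (a + (b - a) * ω) + cyclicHub 𝒯 a b (a + (b - a) * (1 - ω)) =
      if HasRhomb 𝒯 a b .red .black then 1 else 0 := by
  have hne := third_ne hab
  have e1 : Equilateral a b (a + (b - a) * ω) := ⟨hab, Or.inl rfl⟩
  have e2 : Equilateral a b (a + (b - a) * (1 - ω)) := ⟨hab, Or.inr rfl⟩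
  have third (c) (he : Equilateral a b c) : c = a + (b - a) * ω ∨ c = a + (b - a) * (1 - ω) := he.2
  generalize a + (b - a) * ω = c at *
  generalize a + (b - a) * (1 - ω) = d at *
  have m (x) : acuteRhomb a b .red .black ∈ turtle a b x ∧
      acuteRhomb a b .red .black ∈ turtle b x a ∧ acuteRhomb a b .red .black ∈ turtle x a b := by
    simp [redBlack_mem_turtle hab]
  obtain ⟨-, n1, n2, -⟩ := e1.ne
  obtain ⟨-, n3, n4, -⟩ := e2.ne
  unfold cyclicHub hub
  by_cases hr : HasRhomb 𝒯 a b .red .black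
  · rw [if_pos hr]
    obtain ⟨t, ht, hr⟩ := hr
    obtain ⟨p, q, hpq, rfl⟩ | ⟨p, q, r, he, rfl⟩ := h.cases ht
    · simp [acuteRhomb_inj hab] at hr
    · have key {x y z} := h.turtle_mem_iff (x := x) (y := y) (z := z) hab he ht hr
      rw [key e1 (m c).1, key e1.rotate (m c).2.1, key e1.rotate.rotate (m c).2.2,
        key e2 (m d).1, key e2.rotate (m d).2.1, key e2.rotate.rotate (m d).2.2]
      rw [redBlack_mem_turtle hab] at hr
      rcases hr with ⟨rfl, rfl⟩ | ⟨rfl, rfl⟩ | ⟨rfl, rfl⟩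
      · rcases third r he with rfl | rfl <;>
          simp [hab, hne, n1, n2, n3, n4, hab.symm, hne.symm, n1.symm, n2.symm, n3.symm, n4.symm]
      · rcases third p he.rotate with rfl | rfl <;>
          simp [hab, hne, n1, n2, n3, n4, hab.symm, hne.symm, n1.symm, n2.symm, n3.symm, n4.symm]
      · rcases third q he.rotate.rotate with rfl | rfl <;>
          simp [hab, hne, n1, n2, n3, n4, hab.symm, hne.symm, n1.symm, n2.symm, n3.symm, n4.symm]
  · rw [if_neg hr]
    have no {x y z} (hm : acuteRhomb a b .red .black ∈ turtle x y z) : turtle x y z ∉ 𝒯 :=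
      fun ht => hr ⟨_, ht, hm⟩
    simp [no (m c).1, no (m c).2.1, no (m c).2.2, no (m d).1, no (m d).2.1, no (m d).2.2]

open Classical in
/-- A red rhomb is joined to exactly one hub. -/
lemma IsTiling.red_count (h : IsTiling 𝒯) {a b c d : ℂ} (hab : a ≠ b)
    (hc : c = a + (b - a) * ω) (hd : d = a + (b - a) * (1 - ω)) :
    hub 𝒯 c a (c + a - b) + hub 𝒯 c b (c + b - a) + hub 𝒯 d a (d + a - b) +
      hub 𝒯 d b (d + b - a) = if HasRhomb 𝒯 a b .red .red then 1 else 0 := by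
  have hne : c ≠ d := by rw [hc, hd]; exact third_ne hab
  have e1 : Equilateral a b c := ⟨hab, Or.inl hc⟩
  have e2 : Equilateral a b d := ⟨hab, Or.inr hd⟩
  have m (x) : acuteRhomb a b .red .red ∈ turtle x a (x + a - b) ∧
      acuteRhomb a b .red .red ∈ turtle x b (x + b - a) := by
    simp [red_mem_turtle hab]
  unfold hub
  by_cases hr : HasRhomb 𝒯 a b .red .red
  · rw [if_pos hr]
    obtain ⟨t, ht, hr⟩ := hr
    obtain ⟨p, q, hpq, rfl⟩ | ⟨p, q, r, he, rfl⟩ := h.cases ht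
    · simp [acuteRhomb_inj hab] at hr
    · have key {x y z} := h.turtle_mem_iff (x := x) (y := y) (z := z) hab he ht hr
      rw [key e1.reflect (m c).1, key e1.swap.reflect (m c).2,
        key e2.reflect (m d).1, key e2.swap.reflect (m d).2]
      rw [red_mem_turtle hab] at hr
      have hf := he.fst_eq
      rcases hr with ⟨rfl, rfl⟩ | ⟨rfl, rfl⟩
      · have hp : p = c ∨ p = d := by rw [hc, hd]; exact hf
        rcases hp with rfl | rfl <;> simp [hab.symm, hne, hne.symm]
      · have hp : p = c ∨ p = d := by
          rw [hc, hd]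
          refine hf.symm.imp (fun e => ?_) (fun e => ?_) <;> linear_combination e
        rcases hp with rfl | rfl <;> simp [hab, hne, hne.symm]
  · rw [if_neg hr]
    have no {x y z} (hm : acuteRhomb a b .red .red ∈ turtle x y z) : turtle x y z ∉ 𝒯 :=
      fun ht => hr ⟨_, ht, hm⟩
    simp [no (m c).1, no (m c).2, no (m d).1, no (m d).2]

lemma IsTiling.hasRhomb_iff (h : IsTiling 𝒯) {a b : ℂ} (hab : a ≠ b) {c c' d d' : Colour}
    (hr : HasRhomb 𝒯 a b c c') : HasRhomb 𝒯 a b d d' ↔ d = c ∧ d' = c' := by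
  constructor
  · intro hr'; exact h.colours_eq hab hr' hr
  · rintro ⟨rfl, rfl⟩; exact hr

/-- The colours as signs. -/
def Colour.sign : Colour → ℤ
  | .red => 1
  | .black => -1

lemma Colour.sign_opp (c : Colour) : c.opp.sign = -c.sign := by cases c <;> rfl

lemma Colour.sign_cases (c : Colour) : c.sign = 1 ∨ c.sign = -1 := by
  cases c <;> simp [Colour.sign]

/-- A rhomb belongs to exactly one hub if it is red and black, and to none otherwise. -/
lemma IsTiling.hub_count (h : IsTiling 𝒯) {a b c d : ℂ} (hab : a ≠ b)
    (hc : c = a + (b - a) * ω) (hd : d = a + (b - a) * (1 - ω)) {k k' : Colour}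
    (hr : HasRhomb 𝒯 a b k k') :
    (cyclicHub 𝒯 a b c + cyclicHub 𝒯 b a c) + (cyclicHub 𝒯 a b d + cyclicHub 𝒯 b a d) =
      if k.sign = -k'.sign then 1 else 0 := by
  classical
  have h1 := h.redBlack_count hab
  have h2 := h.redBlack_count hab.symm
  rw [h.hasRhomb_iff hab hr, ← hc, ← hd] at h1
  rw [h.hasRhomb_iff hab.symm hr.symm, show b + (a - b) * ω = d by rw [hd]; ring,
    show b + (a - b) * (1 - ω) = c by rw [hc]; ring] at h2
  have : (cyclicHub 𝒯 a b c + cyclicHub 𝒯 b a c) + (cyclicHub 𝒯 a b d + cyclicHub 𝒯 b a d) =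
    (cyclicHub 𝒯 a b c + cyclicHub 𝒯 a b d) + (cyclicHub 𝒯 b a d + cyclicHub 𝒯 b a c) := by ring
  rw [this, h1, h2]
  cases k <;> cases k' <;> simp [Colour.sign]

/-- A rhomb is joined to exactly one hub if it is red, and to none otherwise. -/
lemma IsTiling.joint_count (h : IsTiling 𝒯) {a b c d : ℂ} (hab : a ≠ b)
    (hc : c = a + (b - a) * ω) (hd : d = a + (b - a) * (1 - ω)) {k k' : Colour}
    (hr : HasRhomb 𝒯 a b k k') :
    hub 𝒯 c a (c + a - b) + hub 𝒯 c b (c + b - a) + hub 𝒯 d a (d + a - b) +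
      hub 𝒯 d b (d + b - a) = if k.sign = 1 ∧ k'.sign = 1 then 1 else 0 := by
  classical
  rw [h.red_count hab hc hd, h.hasRhomb_iff hab hr]
  cases k <;> cases k' <;> simp [Colour.sign]

/-! ### The lattice of acute vertices -/

/-- The points of a triangular lattice. -/
noncomputable def latticePoint (p l : ℂ) (x y : ℤ) : ℂ := p + l * (x + y * ω)

/-- A rhomb of the tiling has acute vertex `z`, where it has the colour `c`, and long diagonal
`u`. -/
def HalfRhomb (𝒯 : Set Tile) (z u : ℂ) (c : Colour) : Prop := ∃ c', HasRhomb 𝒯 z (z + u) c c'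

lemma IsTiling.halfRhomb_next (h : IsTiling 𝒯) {z u : ℂ} (hu : u ≠ 0) {c : Colour}
    (hz : HalfRhomb 𝒯 z u c) : HalfRhomb 𝒯 z (u * ω) c.opp := by
  obtain ⟨c', hr⟩ := hz
  simpa [HalfRhomb] using h.next (by simpa using hu) hr

lemma HalfRhomb.reverse {z u : ℂ} {c : Colour} (hz : HalfRhomb 𝒯 z u c) :
    ∃ c', HalfRhomb 𝒯 (z + u) (-u) c' := by
  obtain ⟨c', hr⟩ := hz
  exact ⟨c', c, by simpa using hr.symm⟩

lemma Colour.opp_opp (c : Colour) : c.opp.opp = c := by cases c <;> rfl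

/-- A half turn is three steps of 60 degrees, and three colour changes amount to one. -/
lemma IsTiling.halfRhomb_neg (h : IsTiling 𝒯) {z u : ℂ} (hu : u ≠ 0) {c : Colour}
    (hz : HalfRhomb 𝒯 z u c) : HalfRhomb 𝒯 z (-u) c.opp := by
  have h2 := ω_sq
  have := h.halfRhomb_next (mul_ne_zero (mul_ne_zero hu ω_ne_zero) ω_ne_zero)
    (h.halfRhomb_next (mul_ne_zero hu ω_ne_zero) (h.halfRhomb_next hu hz))
  rw [Colour.opp_opp] at this
  convert this using 1
  linear_combination -u * (ω + 1) * h2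

/-- The rhomb between `z` and `w` leaves `w` in direction `-u`, where the colour is opposite to that
in direction `u`. This is why equal signs mean a red and black rhomb. -/
lemma IsTiling.hasRhomb_of_halves (h : IsTiling 𝒯) {z w u : ℂ} (hu : u ≠ 0) (hw : w = z + u)
    {c c' : Colour} (hz : HalfRhomb 𝒯 z u c) (hz' : HalfRhomb 𝒯 w u c') :
    HasRhomb 𝒯 z w c c'.opp := by
  subst hw
  obtain ⟨d, hr⟩ := hz
  obtain ⟨d', hr'⟩ := h.halfRhomb_neg hu hz'
  rw [add_neg_cancel_right] at hr'
  obtain ⟨-, rfl⟩ := h.colours_eq (by simpa using hu) hr hr'.symm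
  exact hr

/-- The rhombs of a tiling include those of a rhombille tiling. -/
lemma IsTiling.exists_lattice (h : IsTiling 𝒯) : ∃ p l : ℂ, l ≠ 0 ∧
    ∀ x y : ℤ, ∃ c, HalfRhomb 𝒯 (latticePoint p l x y) l c := by
  have h2 := ω_sq
  obtain ⟨t, ht⟩ : ∃ t, t ∈ 𝒯 := by
    have : (0 : ℂ) ∈ ⋃ t ∈ 𝒯, Tile.region t := h.cover ▸ Set.mem_univ _
    simp only [Set.mem_iUnion] at this
    obtain ⟨t, ht, -⟩ := this
    exact ⟨t, ht⟩
  obtain ⟨p, q, c, c', hpq, hr⟩ : ∃ p q c c', p ≠ q ∧ acuteRhomb p q c c' ∈ t := by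
    obtain ⟨p, q, hpq, rfl⟩ | ⟨p, q, r, he, rfl⟩ := h.cases ht
    · exact ⟨p, q, _, _, hpq, rfl⟩
    · exact ⟨p, q, _, _, he.1, Or.inl rfl⟩
  have hl : q - p ≠ 0 := sub_ne_zero.2 hpq.symm
  have hlω := mul_ne_zero hl ω_ne_zero
  refine ⟨p, q - p, hl, ?_⟩
  generalize hlq : q - p = l at *
  let G : ℂ → Prop := fun z => ∃ c, HalfRhomb 𝒯 z l c
  have s1 (z) (hz : G z) : G (z + l) := by
    obtain ⟨c, hc⟩ := hz
    obtain ⟨d, hd⟩ := hc.reverse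
    exact ⟨_, by simpa using h.halfRhomb_neg (neg_ne_zero.2 hl) hd⟩
  have s2 (z) (hz : G z) : G (z - l) := by
    obtain ⟨c, hc⟩ := hz
    obtain ⟨d, hd⟩ := (h.halfRhomb_neg hl hc).reverse
    exact ⟨_, by simpa [sub_eq_add_neg] using hd⟩
  -- Five further turns by 60 degrees lead from direction `l * ω` back to `l`.
  have back (z) (hz : ∃ c, HalfRhomb 𝒯 z (l * ω) c) : G z := by
    obtain ⟨c, hc⟩ := hz
    have := h.halfRhomb_neg (mul_ne_zero hlω ω_ne_zero |> (mul_ne_zero · ω_ne_zero))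
      (h.halfRhomb_next (mul_ne_zero hlω ω_ne_zero) (h.halfRhomb_next hlω hc))
    refine ⟨c.opp.opp.opp, ?_⟩
    rwa [show -(l * ω * ω * ω) = l by linear_combination -l * (ω + 1) * h2] at this
  have s3 (z) (hz : G z) : G (z + l * ω) := by
    obtain ⟨c, hc⟩ := hz
    obtain ⟨d, hd⟩ := (h.halfRhomb_next hl hc).reverse
    exact back _ ⟨_, by simpa using h.halfRhomb_neg (neg_ne_zero.2 hlω) hd⟩
  have s4 (z) (hz : G z) : G (z - l * ω) := by
    obtain ⟨c, hc⟩ := hz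
    obtain ⟨d, hd⟩ := (h.halfRhomb_neg hlω (h.halfRhomb_next hl hc)).reverse
    exact back _ ⟨_, by simpa [sub_eq_add_neg] using hd⟩
  have hx (x : ℤ) : G (latticePoint p l x 0) := by
    induction x using Int.induction_on with
    | zero => exact ⟨c, c', by simpa [latticePoint, ← hlq] using ⟨t, ht, hr⟩⟩
    | succ n ih =>
      convert s1 _ ih using 1; simp only [latticePoint]; push_cast; ring
    | pred n ih =>
      convert s2 _ ih using 1; simp only [latticePoint]; push_cast; ring
  intro x y
  change G _
  induction y using Int.induction_on with
  | zero => exact hx x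
  | succ n ih =>
    convert s3 _ ih using 1; simp only [latticePoint]; push_cast; ring
  | pred n ih =>
    convert s4 _ ih using 1; simp only [latticePoint]; push_cast; ring

/-- Every point of an equilateral triangle lies in one of the rhombs over its sides. -/
lemma mem_region_of_triangle (p l : ℂ) {x y : ℝ} (hx : 0 ≤ x) (hy : 0 ≤ y) (hxy : x + y ≤ 1) :
    (∀ c c', p + l * (x + y * ω) ∈ Rhomb.region (acuteRhomb p (p + l) c c')) ∨
    (∀ c c', p + l * (x + y * ω) ∈ Rhomb.region (acuteRhomb p (p + l * ω) c c')) ∨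
    (∀ c c', p + l * (x + y * ω) ∈ Rhomb.region (acuteRhomb (p + l) (p + l * ω) c c')) := by
  have h2 := ω_sq
  -- The centroid cuts the triangle into three halves of rhombs; the least barycentric coordinate,
  -- opposite the side in question, selects the half.
  by_cases h1 : y ≤ x ∧ y ≤ 1 - x - y
  · left; intro c c'
    have := mem_region p (p + l) c c' (a := x + 2 * y) (b := x - y) (by linarith) (by linarith)
      (by linarith) (by linarith)
    convert this using 1
    push_cast; ring
  by_cases h3 : x ≤ y ∧ x ≤ 1 - x - y
  · right; left; intro c c'
    have := mem_region p (p + l * ω) c c' (a := y - x) (b := 2 * x + y) (by linarith)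
      (by linarith) (by linarith) (by linarith)
    convert this using 1
    push_cast
    linear_combination l * x * h2
  · right; right; intro c c'
    have k1 : 1 - x - y ≤ x := by
      by_contra h; push Not at h
      rcases le_total x y with h' | h'
      · exact h3 ⟨h', h.le⟩
      · exact h1 ⟨h', by linarith⟩
    have k2 : 1 - x - y ≤ y := by
      by_contra h; push Not at h
      rcases le_total x y with h' | h'
      · exact h3 ⟨h', by linarith⟩
      · exact h1 ⟨h', h.le⟩
    have := mem_region (p + l) (p + l * ω) c c' (a := 2 - 2 * x - y) (b := x + 2 * y - 1)
      (by linarith) (by linarith) (by linarith) (by linarith)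
    convert this using 1
    push_cast
    linear_combination -l * (1 - x - y) * h2

section Lattice

variable {p l : ℂ} {c : ℤ → ℤ → Colour}

lemma IsTiling.hasRhomb_zero (h : IsTiling 𝒯) (hl : l ≠ 0)
    (hc : ∀ x y, HalfRhomb 𝒯 (latticePoint p l x y) l (c x y)) (x y : ℤ) :
    HasRhomb 𝒯 (latticePoint p l x y) (latticePoint p l (x + 1) y) (c x y) (c (x + 1) y).opp := by
  refine h.hasRhomb_of_halves hl ?_ (hc _ _) (hc _ _)
  simp only [latticePoint]; push_cast; ring

lemma IsTiling.hasRhomb_one (h : IsTiling 𝒯) (hl : l ≠ 0)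
    (hc : ∀ x y, HalfRhomb 𝒯 (latticePoint p l x y) l (c x y)) (x y : ℤ) :
    HasRhomb 𝒯 (latticePoint p l x y) (latticePoint p l x (y + 1)) (c x y).opp
      (c x (y + 1)) := by
  rw [← Colour.opp_opp (c x (y + 1))]
  refine h.hasRhomb_of_halves (mul_ne_zero hl ω_ne_zero) ?_ (h.halfRhomb_next hl (hc _ _))
    (h.halfRhomb_next hl (hc _ _))
  simp only [latticePoint]; push_cast; ring

lemma IsTiling.hasRhomb_two (h : IsTiling 𝒯) (hl : l ≠ 0)
    (hc : ∀ x y, HalfRhomb 𝒯 (latticePoint p l x y) l (c x y)) (x y : ℤ) :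
    HasRhomb 𝒯 (latticePoint p l (x + 1) y) (latticePoint p l x (y + 1)) (c (x + 1) y)
      (c x (y + 1)).opp := by
  have h2 := ω_sq
  have hlω := mul_ne_zero hl ω_ne_zero
  rw [← Colour.opp_opp (c (x + 1) y), ← Colour.opp_opp (c x (y + 1))]
  refine h.hasRhomb_of_halves (mul_ne_zero hlω ω_ne_zero) ?_
    (h.halfRhomb_next hlω (h.halfRhomb_next hl (hc _ _)))
    (h.halfRhomb_next hlω (h.halfRhomb_next hl (hc _ _)))
  simp only [latticePoint]; push_cast
  linear_combination -l * h2

lemma latticePoint_inj (hl : l ≠ 0) {x y x' y' : ℤ}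
    (h : latticePoint p l x y = latticePoint p l x' y') : x = x' ∧ y = y' := by
  have h1 : l * (((x - x' : ℝ) : ℂ) + ((y - y' : ℝ) : ℂ) * ω) = 0 := by
    simp only [latticePoint] at h
    push_cast
    linear_combination h
  obtain ⟨h2, h3⟩ := int_add_ω_eq_zero ((mul_eq_zero.1 h1).resolve_left hl)
  constructor
  · exact_mod_cast sub_eq_zero.1 h2
  · exact_mod_cast sub_eq_zero.1 h3

/-- The rhombs on the lattice cover the plane. -/
lemma IsTiling.lattice_cover (h : IsTiling 𝒯) (hl : l ≠ 0)
    (hc : ∀ x y, HalfRhomb 𝒯 (latticePoint p l x y) l (c x y)) (z : ℂ) :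
    ∃ x y x' y' k k', latticePoint p l x y ≠ latticePoint p l x' y' ∧
      HasRhomb 𝒯 (latticePoint p l x y) (latticePoint p l x' y') k k' ∧
      z ∈ Rhomb.region (acuteRhomb (latticePoint p l x y) (latticePoint p l x' y') k k') := by
  have key (x y x' y' : ℤ) (hne : x ≠ x' ∨ y ≠ y') {k k'}
      (hr : HasRhomb 𝒯 (latticePoint p l x y) (latticePoint p l x' y') k k')
      (hz : ∀ c c', z ∈ Rhomb.region
        (acuteRhomb (latticePoint p l x y) (latticePoint p l x' y') c c')) :
      ∃ x y x' y' k k', latticePoint p l x y ≠ latticePoint p l x' y' ∧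
        HasRhomb 𝒯 (latticePoint p l x y) (latticePoint p l x' y') k k' ∧
        z ∈ Rhomb.region (acuteRhomb (latticePoint p l x y) (latticePoint p l x' y') k k') := by
    refine ⟨x, y, x', y', k, k', fun e => ?_, hr, hz _ _⟩
    have := latticePoint_inj hl e
    omega
  obtain ⟨a, b, hab⟩ : ∃ a b : ℝ, z = p + l * (a + b * ω) := by
    refine ⟨((z - p) / l).re - ((z - p) / l).im / √3, 2 * ((z - p) / l).im / √3, ?_⟩
    have h3 : √3 ≠ 0 := by positivity
    have : (z - p) / l = (((z - p) / l).re - ((z - p) / l).im / √3 : ℝ) +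
        (2 * ((z - p) / l).im / √3 : ℝ) * ω := by
      apply Complex.ext
      · simp [ω_re, ω_im]; ring
      · simp [ω_re, ω_im]; field_simp
    rw [← this]
    field_simp
    ring
  have ha := Int.floor_add_fract a
  have hb := Int.floor_add_fract b
  have ha0 := Int.fract_nonneg a
  have hb0 := Int.fract_nonneg b
  have ha1 := (Int.fract_lt_one a).le
  have hb1 := (Int.fract_lt_one b).le
  set x := ⌊a⌋
  set y := ⌊b⌋
  generalize Int.fract a = f at *
  generalize Int.fract b = g at *
  have E0 := h.hasRhomb_zero hl hc
  have E1 := h.hasRhomb_one hl hc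
  have E2 := h.hasRhomb_two hl hc
  have ex : latticePoint p l x y + l = latticePoint p l (x + 1) y := by
    simp only [latticePoint]; push_cast; ring
  have ey : latticePoint p l x y + l * ω = latticePoint p l x (y + 1) := by
    simp only [latticePoint]; push_cast; ring
  have fx : latticePoint p l (x + 1) (y + 1) + -l = latticePoint p l x (y + 1) := by
    simp only [latticePoint]; push_cast; ring
  have fy : latticePoint p l (x + 1) (y + 1) + -l * ω = latticePoint p l (x + 1) y := by
    simp only [latticePoint]; push_cast; ring
  rcases le_total (f + g) 1 with hfg | hfg
  · have hz : z = latticePoint p l x y + l * (f + g * ω) := by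
      rw [hab, ← ha, ← hb]; simp only [latticePoint]; push_cast; ring
    have := mem_region_of_triangle (latticePoint p l x y) l ha0 hb0 hfg
    rw [← hz, ex, ey] at this
    rcases this with this | this | this
    · exact key _ _ _ _ (by omega) (E0 x y) this
    · exact key _ _ _ _ (by omega) (E1 x y) this
    · exact key _ _ _ _ (by omega) (E2 x y) this
  -- The downward triangle is the upward one seen from the opposite corner, with `-l` in place of
  -- `l`.
  · have hz : z = latticePoint p l (x + 1) (y + 1) +
        -l * ((1 - f : ℝ) + (1 - g : ℝ) * ω) := by
      rw [hab, ← ha, ← hb]; simp only [latticePoint]; push_cast; ring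
    have := mem_region_of_triangle (latticePoint p l (x + 1) (y + 1)) (-l)
      (x := 1 - f) (y := 1 - g) (by linarith) (by linarith) (by linarith)
    rw [← hz, fx, fy] at this
    rcases this with this | this | this
    · exact key _ _ _ _ (by omega) (E0 x (y + 1)).symm this
    · exact key _ _ _ _ (by omega) (E1 (x + 1) y).symm this
    · exact key _ _ _ _ (by omega) (E2 x y).symm this

/-- All rhombs of the tiling have their acute vertices in the lattice. -/
lemma IsTiling.mem_lattice (h : IsTiling 𝒯) (hl : l ≠ 0)
    (hc : ∀ x y, HalfRhomb 𝒯 (latticePoint p l x y) l (c x y)) {a b : ℂ} (hab : a ≠ b)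
    {k k' : Colour} (hr : HasRhomb 𝒯 a b k k') : ∃ x y, a = latticePoint p l x y := by
  have h2 := ω_sq
  obtain ⟨t, ht, hr⟩ := hr
  obtain ⟨z, hz⟩ := interior_region_nonempty hab
  obtain ⟨x, y, x', y', d, d', hne, ⟨t', ht', hr'⟩, hz'⟩ :=
    h.lattice_cover hl hc z
  obtain ⟨w, hw, hw'⟩ := mem_closure_iff.1 (region_closure hne hz') _ isOpen_interior (hz k k')
  -- The given rhomb thus shares its tile with a lattice rhomb. It remains to see that one rhomb on
  -- the lattice puts its whole tile there, `L` being closed under completing equilateral triangles.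
  obtain rfl := h.eq_of_mem_interior ht ht' hr hr' hw hw'
  let L : ℂ → Prop := fun z => ∃ x y, z = latticePoint p l x y
  have L1 {a b : ℂ} (ha : L a) (hb : L b) : L (a + (b - a) * ω) := by
    obtain ⟨x, y, rfl⟩ := ha
    obtain ⟨x', y', rfl⟩ := hb
    refine ⟨x - (y' - y), y + (x' - x) + (y' - y), ?_⟩
    simp only [latticePoint]; push_cast
    linear_combination l * (y' - y) * h2
  have L2 {a b d : ℂ} (ha : L a) (hb : L b) (hd : L d) : L (a + b - d) := by
    obtain ⟨x, y, rfl⟩ := ha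
    obtain ⟨x', y', rfl⟩ := hb
    obtain ⟨x'', y'', rfl⟩ := hd
    refine ⟨x + x' - x'', y + y' - y'', ?_⟩
    simp only [latticePoint]; push_cast; ring
  have L3 {a b : ℂ} (ha : L a) (hb : L b) : L (a + (b - a) * (1 - ω)) := by
    have := L2 hb ha (L1 ha hb)
    convert this using 1; ring
  have l1 : L (latticePoint p l x y) := ⟨x, y, rfl⟩
  have l2 : L (latticePoint p l x' y') := ⟨x', y', rfl⟩
  change L a
  generalize latticePoint p l x y = m at *
  generalize latticePoint p l x' y' = n at *
  obtain ⟨q, r, hqr, rfl⟩ | ⟨q, r, s, he, rfl⟩ := h.cases ht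
  · rw [Set.mem_singleton_iff, acuteRhomb_inj hab] at hr
    rw [Set.mem_singleton_iff, acuteRhomb_inj hne] at hr'
    grind
  · have third {q r s : ℂ} (he : Equilateral q r s) (hq : L q) (hr : L r) : L s := by
      rcases he.2 with rfl | rfl
      · exact L1 hq hr
      · exact L3 hq hr
    have fst (hr : L r) (hx : L (q + r - s)) : L q ∧ L r := by
      rcases he.fst_eq with e | e
      · exact ⟨e ▸ L1 hr hx, hr⟩
      · exact ⟨e ▸ L3 hr hx, hr⟩
    have snd (hr : L r) (hs : L s) : L q ∧ L r := ⟨third he.rotate hr hs, hr⟩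
    have trd (hs : L s) (hq : L q) : L q ∧ L r := ⟨hq, third he.rotate.rotate hs hq⟩
    have hqr : L q ∧ L r := by
      rw [acuteRhomb_mem_turtle hne] at hr'
      rcases hr' with ⟨rfl, rfl, -⟩ | ⟨rfl, rfl, -⟩ | ⟨rfl, rfl, -⟩ | ⟨rfl, rfl, -⟩ |
        ⟨rfl, rfl, -⟩ | ⟨rfl, rfl, -⟩ | ⟨rfl, rfl, -⟩ | ⟨rfl, rfl, -⟩
      · exact ⟨l1, l2⟩
      · exact ⟨l2, l1⟩
      · exact snd l1 l2
      · exact snd l2 l1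
      · exact trd l1 l2
      · exact trd l2 l1
      · exact fst l1 l2
      · exact fst l2 l1
    have hs := third he hqr.1 hqr.2
    have hx := L2 hqr.1 hqr.2 hs
    rw [acuteRhomb_mem_turtle hab] at hr
    rcases hr with ⟨rfl, -⟩ | ⟨rfl, -⟩ | ⟨rfl, -⟩ | ⟨rfl, -⟩ | ⟨rfl, -⟩ | ⟨rfl, -⟩ | ⟨rfl, -⟩ |
      ⟨rfl, -⟩
    exacts [hqr.1, hqr.2, hqr.2, hs, hs, hqr.1, hqr.2, hx]

end Lattice

/-! ### Periods and the passage to the torus -/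

lemma Tile.map_add_map_add (u v : ℂ) (t : Tile) :
    Tile.map (fun z => z + u) (Tile.map (fun z => z + v) t) = Tile.map (fun z => z + (v + u)) t := by
  simp only [Tile.map, Set.image_image]
  congr 1; funext r
  simp only [Rhomb.map, Set.image_image]
  congr 1; funext s
  simp only [Side.map, add_assoc]

lemma Tile.map_add_zero (t : Tile) : Tile.map (fun z => z + 0) t = t := by
  have h1 : Side.map (fun z => z + 0) = id := by funext s; simp [Side.map]
  have h2 : Rhomb.map (fun z => z + 0) = id := by
    funext r; rw [Rhomb.map, h1, Set.image_id]; rfl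
  rw [Tile.map, h2, Set.image_id]

/-- The group of periods of a set of tiles. -/
def periods (𝒯 : Set Tile) : AddSubgroup ℂ where
  carrier := {v | ∀ t, Tile.map (fun z => z + v) t ∈ 𝒯 ↔ t ∈ 𝒯}
  zero_mem' t := by rw [Tile.map_add_zero]
  add_mem' {u v} hu hv t := by rw [← Tile.map_add_map_add, hv, hu]
  neg_mem' {v} hv t := by rw [← hv, Tile.map_add_map_add, neg_add_cancel, Tile.map_add_zero]

lemma InvariantUnder.mem_periods {v : ℂ} (h : InvariantUnder 𝒯 v) : v ∈ periods 𝒯 := by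
  intro t
  constructor
  · intro ht
    rw [← h] at ht
    obtain ⟨t', ht', e⟩ := ht
    have := congrArg (Tile.map fun z => z + -v) e
    simp only [Tile.map_add_map_add, add_neg_cancel, Tile.map_add_zero] at this
    exact this ▸ ht'
  · intro ht
    rw [← h]
    exact ⟨t, ht, rfl⟩

lemma acuteRhomb_map_add (v p q : ℂ) (c c' : Colour) :
    Rhomb.map (fun z => z + v) (acuteRhomb p q c c') = acuteRhomb (p + v) (q + v) c c' :=
  acuteRhomb_map (IsometryEquiv.addRight v) p q c c'

lemma turtle_map_add (v p q r : ℂ) :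
    Tile.map (fun z => z + v) (turtle p q r) = turtle (p + v) (q + v) (r + v) := by
  simp only [Tile.map, turtle, Set.image_insert_eq, Set.image_singleton, acuteRhomb_map_add]
  congr 4; ring_nf

lemma HasRhomb.add_period {v : ℂ} (hv : v ∈ periods 𝒯) {p q : ℂ} {c c' : Colour}
    (h : HasRhomb 𝒯 p q c c') : HasRhomb 𝒯 (p + v) (q + v) c c' := by
  obtain ⟨t, ht, hr⟩ := h
  exact ⟨_, (hv t).2 ht, acuteRhomb_map_add v p q c c' ▸ Set.mem_image_of_mem _ hr⟩

lemma hub_add_period {v : ℂ} (hv : v ∈ periods 𝒯) (p q r : ℂ) :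
    hub 𝒯 (p + v) (q + v) (r + v) = hub 𝒯 p q r := by
  unfold hub
  rw [← turtle_map_add, hv]

/-- Two independent periods generate a sublattice that contains a multiple of the lattice. -/
lemma IsTiling.exists_period (h : IsTiling 𝒯) {p l : ℂ} {c : ℤ → ℤ → Colour} (hl : l ≠ 0)
    (hc : ∀ x y, HalfRhomb 𝒯 (latticePoint p l x y) l (c x y)) {v w : ℂ}
    (hvw : LinearIndependent ℝ ![v, w]) (hv : v ∈ periods 𝒯) (hw : w ∈ periods 𝒯) :
    ∃ m : ℕ, m ≠ 0 ∧ m * l ∈ periods 𝒯 ∧ m * (l * ω) ∈ periods 𝒯 := by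
  have key (v) (hv : v ∈ periods 𝒯) : ∃ x y : ℤ, v = l * (x + y * ω) := by
    obtain ⟨c', hr⟩ := hc 0 0
    have hr := hr.add_period hv
    obtain ⟨x, y, e⟩ := h.mem_lattice hl hc (by simpa using hl) hr
    refine ⟨x, y, ?_⟩
    simp only [latticePoint] at e
    push_cast at e
    linear_combination e
  obtain ⟨x, y, hx⟩ := key v hv
  obtain ⟨x', y', hx'⟩ := key w hw
  have hD : x * y' - x' * y ≠ 0 := by
    intro hD
    have hD' : (x : ℂ) * y' - x' * y = 0 := by exact_mod_cast hD
    rw [LinearIndependent.pair_iff] at hvw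
    have h1 := hvw y' (-y) (by
      simp only [Complex.real_smul]; push_cast; rw [hx, hx']; linear_combination l * hD')
    have h2 := hvw (-x') x (by
      simp only [Complex.real_smul]; push_cast; rw [hx, hx']; linear_combination l * ω * hD')
    have h3 := hvw 1 0 (by
      have e1 : y = 0 := by exact_mod_cast neg_eq_zero.1 h1.2
      have e2 : x = 0 := by exact_mod_cast h2.2
      rw [hx, e1, e2]; simp)
    exact one_ne_zero h3.1
  -- Cramer's rule: the determinant times `l` and `l * ω` are integer combinations of the periods.
  have h1 : ((x * y' - x' * y : ℤ) : ℂ) * l ∈ periods 𝒯 := by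
    have := (periods 𝒯).sub_mem ((periods 𝒯).zsmul_mem hv y') ((periods 𝒯).zsmul_mem hw y)
    convert this using 1
    simp only [zsmul_eq_mul]; rw [hx, hx']; push_cast; ring
  have h2 : ((x * y' - x' * y : ℤ) : ℂ) * (l * ω) ∈ periods 𝒯 := by
    have := (periods 𝒯).sub_mem ((periods 𝒯).zsmul_mem hw x) ((periods 𝒯).zsmul_mem hv x')
    convert this using 1
    simp only [zsmul_eq_mul]; rw [hx, hx']; push_cast; ring
  refine ⟨(x * y' - x' * y).natAbs, Int.natAbs_ne_zero.2 hD, ?_⟩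
  have e : (((x * y' - x' * y).natAbs : ℕ) : ℂ) = (((x * y' - x' * y).natAbs : ℤ) : ℂ) := by simp
  rw [e]
  rcases Int.natAbs_eq (x * y' - x' * y) with e' | e'
  · rw [← e']; exact ⟨h1, h2⟩
  · have e'' : (((x * y' - x' * y).natAbs : ℤ) : ℂ) = -((x * y' - x' * y : ℤ) : ℂ) := by
      rw [← Int.cast_neg]; congr 1; omega
    rw [e'', neg_mul, neg_mul]
    exact ⟨(periods 𝒯).neg_mem h1, (periods 𝒯).neg_mem h2⟩

/-- A doubly periodic function as a function on the discrete torus. -/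
def toTorus (m : ℕ) {α : Type*} (φ : ℤ → ℤ → α) (g : ZMod m × ZMod m) : α :=
  φ g.1.cast g.2.cast

lemma toTorus_intCast {m : ℕ} {α : Type*} {φ : ℤ → ℤ → α} (h0 : ∀ x y, φ (x + m) y = φ x y)
    (h1 : ∀ x y, φ x (y + m) = φ x y) (x y : ℤ) : toTorus m φ (x, y) = φ x y := by
  have per {ψ : ℤ → α} (h : ∀ x, ψ (x + m) = ψ x) (x : ℤ) : ψ ((x : ZMod m).cast) = ψ x := by
    have hp : Function.Periodic ψ (m : ℤ) := h
    rw [ZMod.coe_intCast]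
    have := hp.int_mul (x / m) (x % m)
    rwa [mul_comm, Int.cast_id, Int.emod_add_mul_ediv, eq_comm] at this
  exact (per (ψ := fun x => φ x _) (fun x => h0 x _) x).trans (per (ψ := φ x) (h1 x) y)

end DualTurtle

/-! ### Translation of the tiling into torus data -/

theorem mainTheorem1 :
    ¬ ∃ 𝒯 : Set DualTurtle.Tile, DualTurtle.IsTiling 𝒯 ∧
      ∃ v w : ℂ, LinearIndependent ℝ ![v, w] ∧
        DualTurtle.InvariantUnder 𝒯 v ∧ DualTurtle.InvariantUnder 𝒯 w := by
  open DualTurtle in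
  rintro ⟨𝒯, h, v, w, hvw, hv, hw⟩
  have w2 := ω_sq
  obtain ⟨p, l, hl, hc⟩ := h.exists_lattice
  choose c hc using hc
  obtain ⟨m, hm, hm0, hm1⟩ := h.exists_period hl hc hvw hv.mem_periods hw.mem_periods
  have : NeZero m := ⟨hm⟩
  have E0 := h.hasRhomb_zero hl hc
  have E1 := h.hasRhomb_one hl hc
  have E2 := h.hasRhomb_two hl hc
  have P0 (x y : ℤ) : latticePoint p l (x + m) y = latticePoint p l x y + m * l := by
    simp only [latticePoint]; push_cast; ring
  have P1 (x y : ℤ) : latticePoint p l x (y + m) = latticePoint p l x y + m * (l * ω) := by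
    simp only [latticePoint]; push_cast; ring
  let s : ℤ → ℤ → ℤ := fun x y => (c x y).sign
  let H : ℤ → ℤ → ℤ → ℤ → ℤ → ℤ → ℤ := fun i j k n x y =>
    hub 𝒯 (latticePoint p l x y) (latticePoint p l (x + i) (y + j))
      (latticePoint p l (x + k) (y + n))
  have ne0 (x y : ℤ) : latticePoint p l x y ≠ latticePoint p l (x + 1) y := fun e => by
    have := (latticePoint_inj hl e).1; omega
  have ne1 (x y : ℤ) : latticePoint p l x y ≠ latticePoint p l x (y + 1) := fun e => by
    have := (latticePoint_inj hl e).2; omega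
  have ne2 (x y : ℤ) : latticePoint p l (x + 1) y ≠ latticePoint p l x (y + 1) := fun e => by
    have := (latticePoint_inj hl e).1; omega
  have hs0 (x y : ℤ) : s (x + m) y = s x y := by
    have e1 := E0 (x + m) y
    have e2 := (E0 x y).add_period hm0
    rw [← P0, ← P0, show x + 1 + m = x + m + 1 by ring] at e2
    simp only [s, (h.colours_eq (ne0 _ _) e1 e2).1]
  have hs1 (x y : ℤ) : s x (y + m) = s x y := by
    have e1 := E0 x (y + m)
    have e2 := (E0 x y).add_period hm1
    rw [← P1, ← P1] at e2
    simp only [s, (h.colours_eq (ne0 _ _) e1 e2).1]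
  have hH0 (i j k n x y : ℤ) : H i j k n (x + m) y = H i j k n x y := by
    simp only [H, show ∀ i, x + m + i = x + i + m by intro i; ring, P0]
    exact hub_add_period hm0 _ _ _
  have hH1 (i j k n x y : ℤ) : H i j k n x (y + m) = H i j k n x y := by
    simp only [H, show ∀ i, y + m + i = y + i + m by intro i; ring, P1]
    exact hub_add_period hm1 _ _ _
  have hS := toTorus_intCast hs0 hs1
  have hH (i j k n) := toTorus_intCast (hH0 i j k n) (hH1 i j k n)
  let S : ZMod m × ZMod m → ℤ := toTorus m s
  let T : ℤ → ℤ → ℤ → ℤ → ZMod m × ZMod m → ℤ := fun i j k n => toTorus m (H i j k n)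
  -- Each triangle carries six possible dual Turtles: two orientations and three places for the red
  -- rhomb. Every term is anchored at the first vertex of its Turtle, so that it is a translate of
  -- one function on the torus.
  let u : ZMod m × ZMod m → ℤ := fun g => T 1 0 0 1 g + T (-1) 1 (-1) 0 (g + (1, 0)) +
    T 0 (-1) 1 (-1) (g + (0, 1)) + (T 0 1 1 0 g + T 1 (-1) 0 (-1) (g + (0, 1)) +
    T (-1) 0 (-1) 1 (g + (1, 0)))
  let d : ZMod m × ZMod m → ℤ := fun g => T 0 1 (-1) 1 (g + (1, 0)) +
    T (-1) 0 0 (-1) (g + (1, 1)) + T 1 (-1) 1 0 (g + (0, 1)) + (T (-1) 1 0 1 (g + (1, 0)) +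
    T 1 0 1 (-1) (g + (0, 1)) + T 0 (-1) (-1) 0 (g + (1, 1)))
  have hcases (g : ZMod m × ZMod m) : ∃ x y : ℤ, g = ((x : ZMod m), (y : ZMod m)) := by
    obtain ⟨x, hx⟩ := ZMod.intCast_surjective g.1
    obtain ⟨y, hy⟩ := ZMod.intCast_surjective g.2
    exact ⟨x, y, by rw [hx, hy]⟩
  have a10 (x y : ℤ) : ((x : ZMod m), (y : ZMod m)) + (1, 0) =
      (((x + 1 : ℤ) : ZMod m), (y : ZMod m)) := by
    simp
  have a01 (x y : ℤ) : ((x : ZMod m), (y : ZMod m)) + (0, 1) =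
      ((x : ZMod m), ((y + 1 : ℤ) : ZMod m)) := by
    simp
  have a11 (x y : ℤ) : ((x : ZMod m), (y : ZMod m)) + (1, 1) =
      (((x + 1 : ℤ) : ZMod m), ((y + 1 : ℤ) : ZMod m)) := by
    simp
  have b10 (x y : ℤ) : ((x : ZMod m), (y : ZMod m)) + (1, -1) =
      (((x + 1 : ℤ) : ZMod m), ((y + -1 : ℤ) : ZMod m)) := by
    simp
  have b01 (x y : ℤ) : ((x : ZMod m), (y : ZMod m)) + (-1, 1) =
      (((x + -1 : ℤ) : ZMod m), ((y + 1 : ℤ) : ZMod m)) := by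
    simp
  have hu (x y : ℤ) : u (x, y) =
      cyclicHub 𝒯 (latticePoint p l x y) (latticePoint p l (x + 1) y) (latticePoint p l x (y + 1)) +
      cyclicHub 𝒯 (latticePoint p l x y) (latticePoint p l x (y + 1))
        (latticePoint p l (x + 1) y) := by
    simp only [u, T, a10, a01, hH]
    simp only [H, cyclicHub, add_neg_cancel_right, add_zero]
  have hd (x y : ℤ) : d (x, y) =
      cyclicHub 𝒯 (latticePoint p l (x + 1) y) (latticePoint p l (x + 1) (y + 1))
        (latticePoint p l x (y + 1)) +
      cyclicHub 𝒯 (latticePoint p l (x + 1) y) (latticePoint p l x (y + 1))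
        (latticePoint p l (x + 1) (y + 1)) := by
    simp only [d, T, a10, a01, a11, hH]
    simp only [H, cyclicHub, add_neg_cancel_right, add_zero]
  have hT (i j k n g) : 0 ≤ T i j k n g := hub_nonneg _ _ _
  refine torus_contradiction S u d (fun g => (c _ _).sign_cases)
    (fun g => by simp only [u]; apply_rules [add_nonneg])
    (fun g => by simp only [d]; apply_rules [add_nonneg]) (fun g => ?_) (fun g => ?_) (fun g => ?_) ?_
  · obtain ⟨x, y, rfl⟩ := hcases g
    have := h.hub_count (c := latticePoint p l x (y + 1 + 1)) (d := latticePoint p l (x + 1) y)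
      (ne0 x (y + 1)) (by simp only [latticePoint]; push_cast; ring)
      (by simp only [latticePoint]; push_cast; ring) (E0 x (y + 1))
    rw [Colour.sign_opp, neg_neg] at this
    simp only [S, a10, a01, hu, hd, hS, s]
    rw [← this]
    unfold cyclicHub
    ring
  · obtain ⟨x, y, rfl⟩ := hcases g
    have := h.hub_count (c := latticePoint p l x (y + 1)) (d := latticePoint p l (x + 1 + 1) y)
      (ne1 (x + 1) y) (by simp only [latticePoint]; push_cast; linear_combination -l * w2)
      (by simp only [latticePoint]; push_cast; linear_combination l * w2) (E1 (x + 1) y)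
    simp only [Colour.sign_opp, neg_inj] at this
    simp only [S, a10, a01, hu, hd, hS, s]
    rw [← this]
    unfold cyclicHub
    ring
  · obtain ⟨x, y, rfl⟩ := hcases g
    have := h.hub_count (c := latticePoint p l x y) (d := latticePoint p l (x + 1) (y + 1))
      (ne2 x y) (by simp only [latticePoint]; push_cast; linear_combination -l * w2)
      (by simp only [latticePoint]; push_cast; linear_combination l * w2) (E2 x y)
    rw [Colour.sign_opp, neg_neg] at this
    simp only [S, a10, a01, hu, hd, hS, s]
    rw [← this]
    unfold cyclicHub
    ring
  · have r0 (g) : (if S g = 1 ∧ S (g + (1, 0)) = -1 then 1 else 0) =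
        T 0 (-1) (-1) 0 (g + (0, 1)) + T 1 (-1) 1 0 (g + (0, 1)) + T (-1) 1 (-1) 0 (g + (1, -1)) +
          T 0 1 1 0 (g + (1, -1)) := by
      obtain ⟨x, y, rfl⟩ := hcases g
      have := h.joint_count (c := latticePoint p l x (y + 1))
        (d := latticePoint p l (x + 1) (y + -1))
        (ne0 x y) (by simp only [latticePoint]; push_cast; ring)
        (by simp only [latticePoint]; push_cast; ring) (E0 x y)
      simp only [Colour.sign_opp, neg_eq_iff_eq_neg] at this
      simp only [S, T, a10, a01, b10, hS, hH, s]
      rw [← this]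
      simp only [H, latticePoint]
      push_cast
      ring_nf
    have r1 (g) : (if S g = -1 ∧ S (g + (0, 1)) = 1 then 1 else 0) =
        T 1 (-1) 0 (-1) (g + (-1, 1)) + T 1 0 0 1 (g + (-1, 1)) + T (-1) 0 0 (-1) (g + (1, 0)) +
          T (-1) 1 0 1 (g + (1, 0)) := by
      obtain ⟨x, y, rfl⟩ := hcases g
      have := h.joint_count (c := latticePoint p l (x + -1) (y + 1))
        (d := latticePoint p l (x + 1) y)
        (ne1 x y) (by simp only [latticePoint]; push_cast; linear_combination -l * w2)
        (by simp only [latticePoint]; push_cast; linear_combination l * w2) (E1 x y)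
      simp only [Colour.sign_opp, neg_eq_iff_eq_neg] at this
      simp only [S, T, a10, a01, b01, hS, hH, s]
      rw [← this]
      simp only [H, latticePoint]
      push_cast
      ring_nf
    have r2 (g) : (if S (g + (1, 0)) = 1 ∧ S (g + (0, 1)) = -1 then 1 else 0) =
        T 1 0 1 (-1) g + T 0 1 (-1) 1 g + T 0 (-1) 1 (-1) (g + (1, 1)) +
          T (-1) 0 (-1) 1 (g + (1, 1)) := by
      obtain ⟨x, y, rfl⟩ := hcases g
      have := h.joint_count (c := latticePoint p l x y) (d := latticePoint p l (x + 1) (y + 1))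
        (ne2 x y) (by simp only [latticePoint]; push_cast; linear_combination -l * w2)
        (by simp only [latticePoint]; push_cast; linear_combination l * w2) (E2 x y)
      simp only [Colour.sign_opp, neg_eq_iff_eq_neg] at this
      simp only [S, T, a10, a01, a11, hS, hH, s]
      rw [← this]
      simp only [H, latticePoint]
      push_cast
      ring_nf
    -- After shifts each of the twelve shapes of Turtle occurs exactly once on either side.
    simp only [r0, r1, r2, u, d, Finset.sum_add_distrib, sum_shift]
    ring
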